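/- A function $\Phi\colon[0,\infty)\to[0,\infty)$ is a $\Phi$-function if it is increasing (not necessarily strictly), $\Phi(0)=0$, $\lim_{t\to0+}\Phi(t)=0$, $\lim_{t\to\infty}\Phi(t)=\infty$ and $\Phi\in(\mathrm{aInc})_1$, where $\Phi\in(\mathrm{aInc})_p$ means that there is $a\ge1$ with $\Phi(s)s^{-p}\le a\,\Phi(t)t^{-p}$ for all $0<s<t$; any such $a$ is an admissible value of the constant $a_\Phi(p)$. Let $\Omega\subset\mathbb R^d$ be compact, let $\mu$ be a Borel probability measure on $\Omega$, and let $C(\Omega)$ be the space of continuous scalar functions on $\Omega$ (scalars $\mathbb K=\mathbb R$ or $\mathbb C$). Put $$\|f\|_{L^\Phi(\mu)}=\inf\Bigl\{\lambda>0:\int_\Omega\Phi(|f|/\lambda)\,d\mu\le1\Bigr\},$$ and let $L^\Phi(\mu)$ be the space of measurable $f$ with $\int_\Omega\Phi(|f|/\lambda)\,d\mu<\infty$ for some $\lambda>0$. A number $C_\Phi$ is called a quasi-triangle constant for $L^\Phi(\mu)$ if $\|f+g\|_{L^\Phi(\mu)}\le C_\Phi(\|f\|_{L^\Phi(\mu)}+\|g\|_{L^\Phi(\mu)})$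 for all $f,g\in L^\Phi(\mu)$. For $\mathbf F\subset C(\Omega)$ the linear sampling numbers and the Kolmogorov widths are $$\varrho_m(\mathbf F,\|\cdot\|_{L^\Phi(\mu)})=\inf_{\mathbf x\subset\Omega,\ \#\mathbf x\le m}\ \inf_{T\colon\mathbb K^{\mathbf x}\to L^\Phi(\mu)\text{ linear}}\ \sup_{f\in\mathbf F}\|f-T(f|_{\mathbf x})\|_{L^\Phi(\mu)},\qquad d_N(\mathbf F,\|\cdot\|_\infty)=\inf_{X}\sup_{f\in\mathbf F}d(f,X)_\infty,$$ where $X$ runs over the linear subspaces of $C(\Omega)$ of dimension at most $N$ and $d(f,X)_\infty=\inf_{u\in X}\|f-u\|_\infty$. All these quantities take values in $[0,\infty]$. **Theorem.** There are numerical constants $c\in\mathbb N$, $c\ge1$, and $C\ge1$ such that the following holds for every $p\in[2,\infty)$ and every $\Phi$-function $\Phi\in(\mathrm{aInc})_p$ with $\Phi(1)>0$. There is a number $C(\Phi,p)\ge1$, depending only on $\Phi$ and $p$, such that for every $N\ge1$, every compact $\Omega\subset\mathbb R^d$ ($d$ arbitrary), every Borel probability measure $\mu$ on $\Omega$ and every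 $\mathbf F\subset C(\Omega)$, $$\varrho_{cN}(\mathbf F,\|\cdot\|_{L^\Phi(\mu)})\le C(\Phi,p)\Bigl(\frac{\Phi(\sqrt N)}{N}\Bigr)^{1/p}d_N(\mathbf F,\|\cdot\|_\infty).$$ The recovery can be done by least squares: for every $N$-dimensional subspace $X_N\subset C(\Omega)$ there are points $x_1,\dots,x_k\in\Omega$ (possibly repeated), $k\le cN$, such that for all data $y\in\mathbb K^k$ the minimizer $\ell(y)$ of $\sum_{j=1}^k|y_j-u(x_j)|^2$ over $u\in X_N$ exists, is unique and is linear in $y$, and $$\|f-\ell(f(x_1),\dots,f(x_k))\|_{L^\Phi(\mu)}\le C(\Phi,p)\Bigl(\frac{\Phi(\sqrt N)}{N}\Bigr)^{1/p}d(f,X_N)_\infty\qquad\text{for all }f\in C(\Omega).$$ Moreover, in both inequalities $C(\Phi,p)$ can be replaced by $$C\cdot C_\Phi\,a_\Phi(p)^{2/p}\bigl(1+\Phi(1)^{-1}\bigr)^{1/p},$$ where $a_\Phi(p)$ is any admissible constant in $\Phi\in(\mathrm{aInc})_p$ and $C_\Phi$ is any quasi-triangle constant for $L^\Phi(\mu)$.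 -/

import Mathlib

open MeasureTheory Filter Topology
open scoped NNReal ENNReal

namespace Orlicz

/-- `t ↦ Φ(t) t⁻ᵖ` is almost increasing on `(0, ∞)` with the constant `a ≥ 1`, i.e. `a` is an
admissible value of the constant `a_Φ(p)`. -/
def AIncWith (Φ : ℝ≥0 → ℝ≥0) (p : ℝ) (a : ℝ≥0) : Prop :=
  1 ≤ a ∧ ∀ s t : ℝ≥0, 0 < s → s < t → Φ s / s ^ p ≤ a * (Φ t / t ^ p)

/-- The class `(aInc)_p`. -/
def AInc (Φ : ℝ≥0 → ℝ≥0) (p : ℝ) : Prop :=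
  ∃ a : ℝ≥0, AIncWith Φ p a

/-- `Φ : [0, ∞) → [0, ∞)` is a (weak) `Φ`-function: it is increasing (not necessarily strictly),
`Φ(0) = 0`, `Φ(t) → 0` as `t → 0+`, `Φ(t) → ∞` as `t → ∞`, and `Φ ∈ (aInc)_1`. -/
structure IsPhiFunction (Φ : ℝ≥0 → ℝ≥0) : Prop where
  monotone : Monotone Φ
  map_zero : Φ 0 = 0
  tendsto_zero : Tendsto Φ (𝓝[>] 0) (𝓝 0)
  tendsto_atTop : Tendsto Φ atTop atTop
  aInc_one : AInc Φ 1

section Space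

variable {𝕜 Ω : Type*} [RCLike 𝕜] [MeasurableSpace Ω] [TopologicalSpace Ω]

/-- The modular `ρ_Φ(f / l) = ∫ Φ(|f| / l) dμ`, with values in `[0, ∞]`. -/
noncomputable def modular (Φ : ℝ≥0 → ℝ≥0) (μ : Measure Ω) (f : Ω → 𝕜) (l : ℝ≥0) : ℝ≥0∞ :=
  ∫⁻ x, (Φ (‖f x‖₊ / l) : ℝ≥0∞) ∂μ

/-- Membership in the Orlicz space `L^Φ(μ)`. -/
def MemOrlicz (Φ : ℝ≥0 → ℝ≥0) (μ : Measure Ω) (f : Ω → 𝕜) : Prop :=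
  AEStronglyMeasurable f μ ∧ ∃ l : ℝ≥0, 0 < l ∧ modular Φ μ f l < ∞

/-- The Luxemburg functional `‖f‖_{L^Φ(μ)} = inf {l > 0 : ρ_Φ(f / l) ≤ 1}`, with values in `[0, ∞]`
(the infimum of the empty set is `∞`). -/
noncomputable def luxNorm (Φ : ℝ≥0 → ℝ≥0) (μ : Measure Ω) (f : Ω → 𝕜) : ℝ≥0∞ :=
  ⨅ (l : ℝ≥0) (_ : 0 < l ∧ modular Φ μ f l ≤ 1), (l : ℝ≥0∞)

/-- `K` is an admissible constant in the quasi-triangle inequality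
`‖f + g‖_Φ ≤ K (‖f‖_Φ + ‖g‖_Φ)`, `f, g ∈ L^Φ(μ)`. -/
def IsQuasiTriangleConst (𝕜 : Type*) [RCLike 𝕜] (Φ : ℝ≥0 → ℝ≥0) (μ : Measure Ω) (K : ℝ≥0) : Prop :=
  ∀ f g : Ω → 𝕜, MemOrlicz Φ μ f → MemOrlicz Φ μ g →
    luxNorm Φ μ (f + g) ≤ K * (luxNorm Φ μ f + luxNorm Φ μ g)

/-- The (linear) sampling number `ϱ_m(F, ‖·‖_{L^Φ(μ)})`: the infimum, over sets `x` of at most `m`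
points of `Ω` and over linear maps `T` from the space `𝕜^x` of samples to `L^Φ(μ)`, of the worst
case error `sup_{f ∈ F} ‖f - T (f|_x)‖_{L^Φ(μ)}`. -/
noncomputable def samplingNumber (Φ : ℝ≥0 → ℝ≥0) (μ : Measure Ω) (F : Set C(Ω, 𝕜)) (m : ℕ) :
    ℝ≥0∞ :=
  ⨅ (x : Finset Ω) (_ : x.card ≤ m) (T : (x → 𝕜) →ₗ[𝕜] (Ω → 𝕜)) (_ : ∀ y, MemOrlicz Φ μ (T y)),
    ⨆ f ∈ F, luxNorm Φ μ (⇑f - T (fun i => f i))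

end Space

section Uniform

variable {𝕜 Ω : Type*} [RCLike 𝕜] [TopologicalSpace Ω] [CompactSpace Ω]

/-- The error `d(f, X)_∞` of best uniform approximation of `f` by elements of `X`. -/
noncomputable def uniformDist (f : C(Ω, 𝕜)) (X : Submodule 𝕜 C(Ω, 𝕜)) : ℝ≥0∞ :=
  ⨅ u ∈ X, ‖f - u‖ₑ

/-- The Kolmogorov width `d_N(F, ‖·‖_∞)`. The infimum is over the subspaces of dimension at most
`N`; it is the same as over those of dimension exactly `N` whenever there are any. -/
noncomputable def kolmogorovWidth (F : Set C(Ω, 𝕜)) (N : ℕ) : ℝ≥0∞ :=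
  ⨅ (X : Submodule 𝕜 C(Ω, 𝕜)) (_ : FiniteDimensional 𝕜 X ∧ Module.finrank 𝕜 X ≤ N),
    ⨆ f ∈ F, uniformDist f X

/-- `T` assigns to every vector `y` of samples at the points `x_1, …, x_k` (which may repeat) the
unique element of `X` that minimizes `∑_j |y_j - u(x_j)|²` over `u ∈ X`. -/
def IsLeastSquares (X : Submodule 𝕜 C(Ω, 𝕜)) {k : ℕ} (x : Fin k → Ω)
    (T : (Fin k → 𝕜) →ₗ[𝕜] C(Ω, 𝕜)) : Prop :=
  ∀ y : Fin k → 𝕜, T y ∈ X ∧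
    ∀ v ∈ X, v ≠ T y → ∑ j, ‖y j - T y (x j)‖ ^ 2 < ∑ j, ‖y j - v (x j)‖ ^ 2

/-- For some `k ≤ m` and some points `x_1, …, x_k`, least squares on `X` at these points is a linear
recovery method whose error in `L^Φ(μ)` is at most `B · d(f, X)_∞` for every continuous `f`. -/
def LeastSquaresRecovers [MeasurableSpace Ω] (Φ : ℝ≥0 → ℝ≥0) (μ : Measure Ω)
    (X : Submodule 𝕜 C(Ω, 𝕜)) (m : ℕ) (B : ℝ≥0) : Prop :=
  ∃ k ≤ m, ∃ (x : Fin k → Ω) (T : (Fin k → 𝕜) →ₗ[𝕜] C(Ω, 𝕜)), IsLeastSquares X x T ∧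
    ∀ f : C(Ω, 𝕜), luxNorm Φ μ (⇑f - ⇑(T fun j => f (x j))) ≤ B * uniformDist f X

end Uniform

/-- The factor `(Φ(√N) / N)^{1/p}`. -/
noncomputable def rate (Φ : ℝ≥0 → ℝ≥0) (p : ℝ) (N : ℕ) : ℝ≥0 :=
  (Φ (NNReal.sqrt N) / N) ^ (1 / p)

end Orlicz

/-! Take any `u` in the `N`-dimensional space `X` and put `g = f - u`, `t = ‖g‖_∞`. Least squares
reproduces the elements of `X`, so the recovery error is `g - v`, where `v` is the least squares fit
to the samples of `g`. Fitting is an orthogonal projection of the data, hence `∑ |v(x_j)|² ≤ ∑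
|g(x_j)|² ≤ 6 N t²`. It remains to choose `6 N` points at which the sum of squares of an element of
`X` controls both its uniform norm and `N` times its squared norm in `L²(μ)`
(`exists_discretization`). Then `v` is at most a constant times `t √N` uniformly and a constant
times `t` in `L²(μ)`; the same holds for `g`.

These two bounds suffice for `L^Φ`: since `p ≥ 2`, `(aInc)_p` gives `Φ(s) ≤ a (Φ(√N) / N) s²` for `s
≤ √N`, and a further division of the argument by `errorFactor` turns this into `Φ(s / errorFactor) ≤
s²` (`AIncWith.map_div_errorFactor_le`), so the modular is dominated by an `L²` norm.

The points come from two constructions. A design of `2 N` points maximizing the determinant of the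
Gram matrix satisfies `‖u‖_∞² ≤ ∑ |u(z_j)|²` (`exists_design`). The average `ν` of `μ` and the
uniform measure on this design therefore has an `L²` norm that controls both norms. A barrier
argument in the manner of Batson, Spielman and Srivastava then discretizes `L²(ν)` from below with
`6 N` unweighted points (`exists_lower_frame`); no upper frame bound is needed. -/

namespace Orlicz

open Matrix
open scoped ComplexOrder

/-! ### Lower frame bounds by a barrier argument. -/

section LowerFrame

variable {𝕜 ι : Type*} [RCLike 𝕜] [Fintype ι] [DecidableEq ι]

/-- The Hermitian matrix with eigenvalues `a` and eigenvectors the columns of `U`. -/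
noncomputable def ofEigen (U : unitaryGroup ι 𝕜) (a : ι → ℝ) : Matrix ι ι 𝕜 :=
  (U : Matrix ι ι 𝕜) * diagonal (fun i => (a i : 𝕜)) * (U : Matrix ι ι 𝕜)ᴴ

lemma ofEigen_mul (U : unitaryGroup ι 𝕜) (a b : ι → ℝ) :
    ofEigen U a * ofEigen U b = ofEigen U (fun i => a i * b i) := by
  have hU : (U : Matrix ι ι 𝕜)ᴴ * (U : Matrix ι ι 𝕜) = 1 := UnitaryGroup.star_mul_self U
  unfold ofEigen
  calc _ = (U : Matrix ι ι 𝕜) * diagonal (fun i => (a i : 𝕜)) *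
        ((U : Matrix ι ι 𝕜)ᴴ * (U : Matrix ι ι 𝕜)) * diagonal (fun i => (b i : 𝕜)) *
        (U : Matrix ι ι 𝕜)ᴴ := by simp only [Matrix.mul_assoc]
    _ = _ := by
      rw [hU, Matrix.mul_one, Matrix.mul_assoc (U : Matrix ι ι 𝕜), diagonal_mul_diagonal]
      simp

lemma ofEigen_const (U : unitaryGroup ι 𝕜) (t : ℝ) :
    ofEigen U (fun _ => t) = (t : 𝕜) • (1 : Matrix ι ι 𝕜) := by
  have hU : (U : Matrix ι ι 𝕜) * (U : Matrix ι ι 𝕜)ᴴ = 1 := Unitary.coe_mul_star_self U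
  have : diagonal (fun _ : ι => (t : 𝕜)) = (t : 𝕜) • (1 : Matrix ι ι 𝕜) := by
    rw [smul_one_eq_diagonal]
  rw [ofEigen, this]
  simp [hU]

lemma ofEigen_sub (U : unitaryGroup ι 𝕜) (a b : ι → ℝ) :
    ofEigen U a - ofEigen U b = ofEigen U (fun i => a i - b i) := by
  simp only [ofEigen, ← Matrix.sub_mul, ← Matrix.mul_sub, diagonal_sub, RCLike.ofReal_sub]

lemma re_trace_ofEigen (U : unitaryGroup ι 𝕜) (a : ι → ℝ) :
    RCLike.re (ofEigen U a).trace = ∑ i, a i := by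
  have hU : (U : Matrix ι ι 𝕜)ᴴ * (U : Matrix ι ι 𝕜) = 1 := UnitaryGroup.star_mul_self U
  rw [ofEigen, Matrix.mul_assoc, trace_mul_comm, Matrix.mul_assoc, hU, Matrix.mul_one,
    trace_diagonal]
  simp

lemma ofEigen_posDef (U : unitaryGroup ι 𝕜) {a : ι → ℝ} (ha : ∀ i, 0 < a i) :
    (ofEigen U a).PosDef := by
  refine PosDef.mul_mul_conjTranspose_same (PosDef.diagonal fun i => ?_) ?_
  · exact_mod_cast ha i
  · have hU : (U : Matrix ι ι 𝕜) * (U : Matrix ι ι 𝕜)ᴴ = 1 := Unitary.coe_mul_star_self U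
    intro v w h
    simpa [vecMul_vecMul, hU] using congrArg (fun z => z ᵥ* (U : Matrix ι ι 𝕜)ᴴ) h

lemma ofEigen_inv (U : unitaryGroup ι 𝕜) {a : ι → ℝ} (ha : ∀ i, 0 < a i) :
    (ofEigen U a)⁻¹ = ofEigen U (fun i => (a i)⁻¹) := by
  refine inv_eq_right_inv ?_
  rw [ofEigen_mul]
  simp_rw [mul_inv_cancel₀ (ha _).ne']
  simpa using ofEigen_const (𝕜 := 𝕜) U 1

lemma _root_.Matrix.PosDef.exists_eq_ofEigen {P : Matrix ι ι 𝕜} (hP : P.PosDef) :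
    ∃ (U : unitaryGroup ι 𝕜) (a : ι → ℝ), (∀ i, 0 < a i) ∧ P = ofEigen U a :=
  ⟨hP.1.eigenvectorUnitary, hP.1.eigenvalues, hP.eigenvalues_pos, by
    conv_lhs => rw [hP.1.spectral_theorem]
    rfl⟩

/-- Shifting a positive definite matrix whose inverse has trace at most `1` by one third. -/
lemma posDef_sub_third {P : Matrix ι ι 𝕜} (hP : P.PosDef) (ht : RCLike.re P⁻¹.trace ≤ 1) :
    let M := P - ((1 / 3 : ℝ) : 𝕜) • (1 : Matrix ι ι 𝕜)
    M.PosDef ∧ RCLike.re M⁻¹.trace ≤ 3 / 2 ∧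
      RCLike.re M⁻¹.trace - RCLike.re P⁻¹.trace ≤ 1 / 3 * RCLike.re (M⁻¹ * M⁻¹).trace := by
  obtain ⟨U, a, ha, rfl⟩ := hP.exists_eq_ofEigen
  intro M
  rw [ofEigen_inv U ha, re_trace_ofEigen] at ht ⊢
  -- Each reciprocal eigenvalue is at most the trace of the inverse. Hence `a i - 1 / 3 ≥ (2 / 3) a
  -- i`, which gives the factor `3 / 2` below.
  have h1 : ∀ i, 1 ≤ a i := fun i => by
    have := (Finset.single_le_sum (f := fun i => (a i)⁻¹)
      (fun i _ => (inv_pos.2 (ha i)).le) (Finset.mem_univ i)).trans ht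
    exact (inv_le_one₀ (ha i)).1 this
  have h2 : ∀ i, 0 < a i - 1 / 3 := fun i => by linarith [h1 i]
  have hM : M = ofEigen U (fun i => a i - 1 / 3) := by
    rw [← ofEigen_sub, ofEigen_const]
  rw [hM, ofEigen_inv U h2, ofEigen_mul, re_trace_ofEigen, re_trace_ofEigen]
  refine ⟨ofEigen_posDef U h2, ?_, ?_⟩
  · calc ∑ i, (a i - 1 / 3)⁻¹ ≤ ∑ i, 3 / 2 * (a i)⁻¹ := by
          refine Finset.sum_le_sum fun i _ => ?_
          rw [inv_le_iff_one_le_mul₀ (h2 i), mul_assoc, mul_sub, inv_mul_cancel₀ (ha i).ne']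
          have := (inv_le_one₀ (ha i)).2 (h1 i)
          linarith
      _ ≤ 3 / 2 := by rw [← Finset.mul_sum]; linarith
  · rw [← Finset.sum_sub_distrib, Finset.mul_sum]
    refine Finset.sum_le_sum fun i _ => ?_
    have h3 : (a i)⁻¹ ≤ (a i - 1 / 3)⁻¹ := inv_anti₀ (h2 i) (by linarith)
    have h4 : (a i - 1 / 3)⁻¹ - (a i)⁻¹ = 1 / 3 * ((a i - 1 / 3)⁻¹ * (a i)⁻¹) := by
      rw [inv_sub_inv (h2 i).ne' (ha i).ne', ← mul_inv, div_eq_mul_inv]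
      congr 1
      ring
    rw [h4]
    have := inv_pos.2 (h2 i)
    gcongr

/-- The Sherman–Morrison formula, for the trace. -/
lemma trace_inv_add_vecMulVec {M : Matrix ι ι 𝕜} (hM : IsUnit M) (s r : ι → 𝕜)
    (h : 1 + r ⬝ᵥ M⁻¹ *ᵥ s ≠ 0) :
    (M + vecMulVec s r)⁻¹.trace =
      M⁻¹.trace - (r ⬝ᵥ (M⁻¹ * M⁻¹) *ᵥ s) / (1 + r ⬝ᵥ M⁻¹ *ᵥ s) := by
  have hd : IsUnit M.det := (isUnit_iff_isUnit_det M).1 hM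
  have key : (M + vecMulVec s r)⁻¹ =
      M⁻¹ - (1 + r ⬝ᵥ M⁻¹ *ᵥ s)⁻¹ • vecMulVec (M⁻¹ *ᵥ s) (r ᵥ* M⁻¹) := by
    refine inv_eq_right_inv ?_
    have e1 : M * vecMulVec (M⁻¹ *ᵥ s) (r ᵥ* M⁻¹) = vecMulVec s (r ᵥ* M⁻¹) := by
      rw [mul_vecMulVec, mulVec_mulVec, mul_nonsing_inv _ hd, one_mulVec]
    have e2 : vecMulVec s r * vecMulVec (M⁻¹ *ᵥ s) (r ᵥ* M⁻¹) =
        (r ⬝ᵥ M⁻¹ *ᵥ s) • vecMulVec s (r ᵥ* M⁻¹) := by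
      rw [vecMulVec_mul_vecMulVec, vecMulVec_smul]
    rw [Matrix.add_mul, Matrix.mul_sub, Matrix.mul_sub, mul_nonsing_inv _ hd, vecMulVec_mul,
      Matrix.mul_smul, Matrix.mul_smul, e1, e2, smul_smul]
    have : vecMulVec s (r ᵥ* M⁻¹) = ((1 + r ⬝ᵥ M⁻¹ *ᵥ s)⁻¹ + (1 + r ⬝ᵥ M⁻¹ *ᵥ s)⁻¹ *
        (r ⬝ᵥ M⁻¹ *ᵥ s)) • vecMulVec s (r ᵥ* M⁻¹) := by
      rw [← mul_one_add, inv_mul_cancel₀ h, one_smul]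
    nth_rw 2 [this]
    rw [add_smul]
    abel
  rw [key, trace_sub, trace_smul, trace_vecMulVec, dotProduct_comm (M⁻¹ *ᵥ s), ← dotProduct_mulVec,
    mulVec_mulVec, smul_eq_mul, div_eq_inv_mul]

omit [DecidableEq ι] in
lemma _root_.Matrix.PosSemidef.dotProduct_mulVec_star_eq {Q : Matrix ι ι 𝕜} (hQ : Q.PosSemidef)
    (r : ι → 𝕜) : 0 ≤ RCLike.re (r ⬝ᵥ Q *ᵥ star r) ∧
      r ⬝ᵥ Q *ᵥ star r = (RCLike.re (r ⬝ᵥ Q *ᵥ star r) : 𝕜) := by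
  have h := hQ.dotProduct_mulVec_nonneg (star r)
  rw [star_star] at h
  obtain ⟨h1, h2⟩ := RCLike.nonneg_iff.1 h
  exact ⟨h1, RCLike.ext (by simp) (by simp [h2])⟩

section Integral

variable {Ω : Type*} [MeasurableSpace Ω] {ν : Measure Ω} {r : Ω → ι → 𝕜}

/-- The form is linear in the products `star (r i) * r j`, whose means are the entries of the
identity. This supplies the averages from which the next point is chosen. -/
lemma hasIntegral_quadraticForm
    (hI : ∀ i j, Integrable (fun x => star (r x i) * r x j) ν)
    (hE : ∀ i j, ∫ x, star (r x i) * r x j ∂ν = (1 : Matrix ι ι 𝕜) i j) (Q : Matrix ι ι 𝕜) :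
    Integrable (fun x => RCLike.re (r x ⬝ᵥ Q *ᵥ star (r x))) ν ∧
      ∫ x, RCLike.re (r x ⬝ᵥ Q *ᵥ star (r x)) ∂ν = RCLike.re Q.trace := by
  have e : (fun x => r x ⬝ᵥ Q *ᵥ star (r x)) =
      fun x => ∑ i, ∑ j, Q i j * (star (r x j) * r x i) := by
    funext x
    simp only [dotProduct, mulVec, Finset.mul_sum, Pi.star_apply]
    exact Finset.sum_congr rfl fun i _ => Finset.sum_congr rfl fun j _ => by ring
  have h1 : ∀ i j, Integrable (fun x => Q i j * (star (r x j) * r x i)) ν :=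
    fun i j => (hI j i).const_mul _
  have h2 : ∀ i, Integrable (fun x => ∑ j, Q i j * (star (r x j) * r x i)) ν :=
    fun i => integrable_finsetSum _ fun j _ => h1 i j
  have hi : Integrable (fun x => r x ⬝ᵥ Q *ᵥ star (r x)) ν := by
    rw [e]
    exact integrable_finsetSum _ fun i _ => h2 i
  refine ⟨hi.re, ?_⟩
  rw [integral_re hi, e, integral_finsetSum _ fun i _ => h2 i]
  congr 1
  refine Finset.sum_congr rfl fun i _ => ?_
  rw [integral_finsetSum _ fun j _ => h1 i j]
  simp_rw [integral_const_mul, hE]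
  simp [one_apply]

variable [IsProbabilityMeasure ν]

/-- One step of the lower barrier argument: the barrier moves up by `1/3` and a rank one matrix is
added without increasing the trace of the inverse. -/
lemma exists_barrier_step
    (hI : ∀ i j, Integrable (fun x => star (r x i) * r x j) ν)
    (hE : ∀ i j, ∫ x, star (r x i) * r x j ∂ν = (1 : Matrix ι ι 𝕜) i j)
    {P : Matrix ι ι 𝕜} (hP : P.PosDef) (ht : RCLike.re P⁻¹.trace ≤ 1) :
    ∃ x, let P' := P - ((1 / 3 : ℝ) : 𝕜) • (1 : Matrix ι ι 𝕜) + vecMulVec (star (r x)) (r x)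
      P'.PosDef ∧ RCLike.re P'⁻¹.trace ≤ 1 := by
  obtain ⟨hM, h1, h2⟩ := posDef_sub_third hP ht
  set M := P - ((1 / 3 : ℝ) : 𝕜) • (1 : Matrix ι ι 𝕜)
  set Δ := RCLike.re M⁻¹.trace - RCLike.re P⁻¹.trace
  have hM2 : (M⁻¹ * M⁻¹).PosSemidef := by
    have := posSemidef_conjTranspose_mul_self M⁻¹
    rwa [hM.inv.1.eq] at this
  have ht1 : 0 ≤ RCLike.re M⁻¹.trace := (RCLike.nonneg_iff.1 hM.inv.posSemidef.trace_nonneg).1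
  have ht2 : 0 ≤ RCLike.re (M⁻¹ * M⁻¹).trace := (RCLike.nonneg_iff.1 hM2.trace_nonneg).1
  obtain ⟨i1, e1⟩ := hasIntegral_quadraticForm hI hE M⁻¹
  obtain ⟨i2, e2⟩ := hasIntegral_quadraticForm hI hE (M⁻¹ * M⁻¹)
  have i3 : Integrable (fun x => 1 + RCLike.re (r x ⬝ᵥ M⁻¹ *ᵥ star (r x))) ν :=
    (integrable_const 1).add i1
  -- Some point does at least as well as the mean. By Sherman–Morrison, adding the point `x` lowers
  -- the trace of the inverse by a quotient; a nonnegative value of this function at `x` means that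
  -- the quotient makes up for the increase `Δ` caused by the shift.
  obtain ⟨x, hx⟩ := exists_integral_le (μ := ν) (f := fun x =>
    RCLike.re (r x ⬝ᵥ (M⁻¹ * M⁻¹) *ᵥ star (r x)) -
      Δ * (1 + RCLike.re (r x ⬝ᵥ M⁻¹ *ᵥ star (r x))))
    (i2.sub (i3.const_mul Δ))
  rw [integral_sub i2 (i3.const_mul Δ), integral_const_mul,
    integral_add (integrable_const 1) i1, e1, e2] at hx
  simp only [integral_const, probReal_univ, smul_eq_mul, mul_one] at hx
  obtain ⟨k0, k1⟩ := hM.inv.posSemidef.dotProduct_mulVec_star_eq (r x)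
  set κ := RCLike.re (r x ⬝ᵥ M⁻¹ *ᵥ star (r x))
  have hx' : Δ * (1 + κ) ≤ RCLike.re (r x ⬝ᵥ (M⁻¹ * M⁻¹) *ᵥ star (r x)) := by
    -- For `Δ ≥ 0` the left side is at most `(1/3) (1 + 3/2) = 5/6` times the right side.
    have : Δ * (1 + RCLike.re M⁻¹.trace) ≤ RCLike.re (M⁻¹ * M⁻¹).trace := by
      rcases le_total 0 Δ with h | h <;> nlinarith
    linarith
  have hk : (1 : 𝕜) + r x ⬝ᵥ M⁻¹ *ᵥ star (r x) = ((1 + κ : ℝ) : 𝕜) := by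
    rw [k1]; push_cast; rfl
  refine ⟨x, hM.add_posSemidef (posSemidef_vecMulVec_star_self _), ?_⟩
  rw [trace_inv_add_vecMulVec hM.isUnit, hk, map_sub, RCLike.div_re_ofReal]
  · have : Δ ≤ RCLike.re (r x ⬝ᵥ (M⁻¹ * M⁻¹) *ᵥ star (r x)) / (1 + κ) := by
      rwa [le_div_iff₀ (by linarith)]
    linarith
  · rw [hk]
    exact_mod_cast (by linarith : (1 + κ) ≠ 0)

/-- The barrier `k / 3 - N` stays below the spectrum of the Gram matrix of `k` points. At the start
the matrix is `N` times the identity, and the trace of its inverse is `card ι / N ≤ 1`. -/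
lemma exists_barrier
    (hI : ∀ i j, Integrable (fun x => star (r x i) * r x j) ν)
    (hE : ∀ i j, ∫ x, star (r x i) * r x j ∂ν = (1 : Matrix ι ι 𝕜) i j)
    {N : ℕ} (hN : 1 ≤ N) (hι : Fintype.card ι ≤ N) (k : ℕ) :
    ∃ x : Fin k → Ω, let P := ((N - k / 3 : ℝ) : 𝕜) • (1 : Matrix ι ι 𝕜) +
        ∑ j, vecMulVec (star (r (x j))) (r (x j))
      P.PosDef ∧ RCLike.re P⁻¹.trace ≤ 1 := by
  have hN0 : (0 : ℝ) < N := by exact_mod_cast hN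
  induction k with
  | zero =>
    refine ⟨Fin.elim0, ?_⟩
    have h : ((N - (0 : ℕ) / 3 : ℝ) : 𝕜) • (1 : Matrix ι ι 𝕜) +
        ∑ j : Fin 0, vecMulVec (star (r (Fin.elim0 j))) (r (Fin.elim0 j)) =
        ofEigen 1 (fun _ => (N : ℝ)) := by
      rw [ofEigen_const]; simp
    simp only [h]
    refine ⟨ofEigen_posDef _ fun _ => hN0, ?_⟩
    rw [ofEigen_inv _ fun _ => hN0, re_trace_ofEigen]
    simp only [Finset.sum_const, Finset.card_univ, nsmul_eq_mul]
    rw [← div_eq_mul_inv, div_le_one hN0]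
    exact_mod_cast hι
  | succ k ih =>
    obtain ⟨x, hP, ht⟩ := ih
    obtain ⟨y, hy⟩ := exists_barrier_step hI hE hP ht
    refine ⟨Fin.snoc x y, ?_⟩
    have h : ((N - (k + 1 : ℕ) / 3 : ℝ) : 𝕜) = ((N - k / 3 : ℝ) : 𝕜) - ((1 / 3 : ℝ) : 𝕜) := by
      push_cast
      ring
    simpa only [Fin.sum_univ_castSucc, Fin.snoc_castSucc, Fin.snoc_last, h, sub_smul,
      add_sub_right_comm, ← add_assoc] using hy

omit [DecidableEq ι] in
lemma star_dotProduct_sum_vecMulVec {κ : Type*} [Fintype κ] (s : κ → ι → 𝕜) (c : ι → 𝕜) :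
    star c ⬝ᵥ (∑ j, vecMulVec (star (s j)) (s j)) *ᵥ c =
      ((∑ j, ‖s j ⬝ᵥ c‖ ^ 2 : ℝ) : 𝕜) := by
  rw [sum_mulVec, dotProduct_sum]
  push_cast
  refine Finset.sum_congr rfl fun j _ => ?_
  rw [vecMulVec_mulVec, ← RCLike.conj_mul]
  rw [dotProduct_smul, star_dotProduct_star, dotProduct_comm]
  simp

/-- After `6 N` steps of size `1 / 3` the barrier has moved from `-N` to `N`. -/
lemma exists_lower_frame_of_orthonormal
    (hI : ∀ i j, Integrable (fun x => star (r x i) * r x j) ν)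
    (hE : ∀ i j, ∫ x, star (r x i) * r x j ∂ν = (1 : Matrix ι ι 𝕜) i j)
    {N : ℕ} (hN : 1 ≤ N) (hι : Fintype.card ι ≤ N) :
    ∃ x : Fin (6 * N) → Ω, ∀ c : ι → 𝕜,
      N * RCLike.re (star c ⬝ᵥ c) ≤ ∑ j, ‖r (x j) ⬝ᵥ c‖ ^ 2 := by
  obtain ⟨x, hP, -⟩ := exists_barrier hI hE hN hι (6 * N)
  refine ⟨x, fun c => ?_⟩
  have h := hP.posSemidef.dotProduct_mulVec_nonneg c
  have h6 : (N - (6 * N : ℕ) / 3 : ℝ) = -N := by push_cast; ring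
  rw [h6, add_mulVec, dotProduct_add, star_dotProduct_sum_vecMulVec, smul_mulVec, one_mulVec,
    dotProduct_smul, smul_eq_mul] at h
  have := (RCLike.nonneg_iff.1 h).1
  rw [map_add, RCLike.re_ofReal_mul, RCLike.ofReal_re] at this
  linarith

/-- **Subsampling with a lower frame bound.** If `G` is the Gram matrix in `L²(ν)` of linearly
independent functions, then there are `6 N` points at which the sum of squares of every linear
combination is at least `N` times its squared norm in `L²(ν)`. -/
lemma exists_lower_frame {G : Matrix ι ι 𝕜} (hG : G.PosDef)
    (hI : ∀ i j, Integrable (fun x => star (r x i) * r x j) ν)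
    (hE : ∀ i j, ∫ x, star (r x i) * r x j ∂ν = G i j)
    {N : ℕ} (hN : 1 ≤ N) (hι : Fintype.card ι ≤ N) :
    ∃ x : Fin (6 * N) → Ω, ∀ c : ι → 𝕜,
      N * RCLike.re (star c ⬝ᵥ G *ᵥ c) ≤ ∑ j, ‖r (x j) ⬝ᵥ c‖ ^ 2 := by
  obtain ⟨U, a, ha, rfl⟩ := hG.exists_eq_ofEigen
  have hs : ∀ i, 0 < √(a i) := fun i => Real.sqrt_pos.2 (ha i)
  -- `S` and `R` are the square root of the Gram matrix and its inverse: `r R` is orthonormal, and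
  -- passing from `c` to `S c` leaves the functions unchanged.
  set S := ofEigen U fun i => √(a i)
  set R := ofEigen U fun i => (√(a i))⁻¹
  have hSS : S * S = ofEigen U a := by
    rw [ofEigen_mul]; congr 1; funext i; exact Real.mul_self_sqrt (ha i).le
  have hR : Rᴴ = R := (ofEigen_posDef U fun i => inv_pos.2 (hs i)).1.eq
  have hS : Sᴴ = S := (ofEigen_posDef U hs).1.eq
  have hRS : R * S = 1 := by
    rw [ofEigen_mul]
    simp_rw [inv_mul_cancel₀ (hs _).ne']
    simpa using ofEigen_const (𝕜 := 𝕜) U 1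
  have hSR : S * R = 1 := mul_eq_one_comm.1 hRS
  have hRGR : R * ofEigen U a * R = 1 := by
    rw [← hSS, ← Matrix.mul_assoc, hRS, Matrix.one_mul, hSR]
  have e : ∀ i j, (fun x => star ((r x ᵥ* R) i) * (r x ᵥ* R) j) =
      fun x => ∑ k, ∑ l, R i k * R l j * (star (r x k) * r x l) := by
    intro i j
    funext x
    simp only [vecMul, dotProduct, star_sum, star_mul, Finset.sum_mul_sum]
    refine Finset.sum_congr rfl fun k _ => Finset.sum_congr rfl fun l _ => ?_
    have : star (R k i) = R i k := by rw [← conjTranspose_apply, hR]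
    rw [this]
    ring
  have hIk : ∀ i j k l, Integrable (fun x => R i k * R l j * (star (r x k) * r x l)) ν :=
    fun i j k l => (hI k l).const_mul _
  obtain ⟨x, hx⟩ := exists_lower_frame_of_orthonormal (ν := ν) (r := fun x => r x ᵥ* R)
    (fun i j => by
      rw [e]
      exact integrable_finsetSum _ fun k _ => integrable_finsetSum _ fun l _ => hIk i j k l)
    (fun i j => by
      rw [e, integral_finsetSum _ fun k _ => integrable_finsetSum _ fun l _ => hIk i j k l]
      simp_rw [integral_finsetSum _ fun l _ => hIk i j _ l, integral_const_mul, hE]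
      rw [← hRGR, Matrix.mul_apply]
      simp_rw [Matrix.mul_apply, Finset.sum_mul]
      rw [Finset.sum_comm]
      exact Finset.sum_congr rfl fun k _ => Finset.sum_congr rfl fun l _ => by ring)
    hN hι
  refine ⟨x, fun c => ?_⟩
  have h := hx (S *ᵥ c)
  have e1 : star (S *ᵥ c) ⬝ᵥ S *ᵥ c = star c ⬝ᵥ ofEigen U a *ᵥ c := by
    rw [star_mulVec, hS, ← dotProduct_mulVec, mulVec_mulVec, hSS]
  have e2 : ∀ j, (r (x j) ᵥ* R) ⬝ᵥ S *ᵥ c = r (x j) ⬝ᵥ c := fun j => by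
    rw [← dotProduct_mulVec, mulVec_mulVec, hRS, one_mulVec]
  simpa only [e1, e2] using h

end Integral

end LowerFrame

/-! ### Designs of maximal determinant. -/

section Design

variable {𝕜 ι κ Ω : Type*} [RCLike 𝕜] [Fintype κ]

/-- The Gram matrix of the point evaluations at the points `x j`. -/
def gram (r : Ω → ι → 𝕜) (x : κ → Ω) : Matrix ι ι 𝕜 :=
  ∑ j, vecMulVec (star (r (x j))) (r (x j))

lemma gram_update [DecidableEq κ] (r : Ω → ι → 𝕜) (x : κ → Ω) (j : κ) (y : Ω) :
    gram r (Function.update x j y) =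
      gram r x + (vecMulVec (star (r y)) (r y) - vecMulVec (star (r (x j))) (r (x j))) := by
  unfold gram
  rw [← Finset.add_sum_erase _ _ (Finset.mem_univ j), ← Finset.add_sum_erase Finset.univ
    (fun j => vecMulVec (star (r (x j))) (r (x j))) (Finset.mem_univ j), Function.update_self]
  have : ∑ i ∈ Finset.univ.erase j, vecMulVec (star (r (Function.update x j y i)))
      (r (Function.update x j y i)) =
      ∑ i ∈ Finset.univ.erase j, vecMulVec (star (r (x i))) (r (x i)) :=
    Finset.sum_congr rfl fun i hi => by rw [Function.update_of_ne (Finset.ne_of_mem_erase hi)]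
  rw [this]
  abel

variable [Fintype ι]

lemma gram_posSemidef (r : Ω → ι → 𝕜) (x : κ → Ω) : (gram r x).PosSemidef :=
  posSemidef_sum _ fun _ _ => posSemidef_vecMulVec_star_self _

lemma star_dotProduct_gram_mulVec (r : Ω → ι → 𝕜) (x : κ → Ω) (c : ι → 𝕜) :
    star c ⬝ᵥ gram r x *ᵥ c = ((∑ j, ‖r (x j) ⬝ᵥ c‖ ^ 2 : ℝ) : 𝕜) :=
  star_dotProduct_sum_vecMulVec (fun j => r (x j)) c

/-- The vectors `r y` have a spanning subfamily of at most `card ι` members. This provides one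
design with nonzero determinant, so that the maximal determinant is nonzero. -/
lemma exists_points_separating [Nonempty Ω] {r : Ω → ι → 𝕜}
    (hr : ∀ c, (∀ y, r y ⬝ᵥ c = 0) → c = 0) {k : ℕ} (hk : Fintype.card ι ≤ k) :
    ∃ x : Fin k → Ω, ∀ c, (∀ j, r (x j) ⬝ᵥ c = 0) → c = 0 := by
  obtain ⟨f, hf, hspan, -⟩ := Submodule.exists_fun_fin_finrank_span_eq 𝕜 (Set.range r)
  have hn : Module.finrank 𝕜 (Submodule.span 𝕜 (Set.range r)) ≤ k := by
    have := Submodule.finrank_le (Submodule.span 𝕜 (Set.range r))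
    rw [Module.finrank_fintype_fun_eq_card] at this
    exact this.trans hk
  choose z hz using hf
  -- The points beyond the spanning subfamily are arbitrary.
  refine ⟨fun j => if h : (j : ℕ) < _ then z ⟨j, h⟩ else Classical.arbitrary Ω,
    fun c hc => hr c fun y => ?_⟩
  have hle : Submodule.span 𝕜 (Set.range f) ≤ LinearMap.ker (dotProductBilin 𝕜 𝕜 |>.flip c) := by
    rw [Submodule.span_le]
    rintro _ ⟨i, rfl⟩
    have := hc (Fin.castLE hn i)
    simpa [hz] using this
  have hy : r y ∈ Submodule.span 𝕜 (Set.range f) :=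
    hspan.ge (Submodule.subset_span (Set.mem_range_self y))
  simpa using hle hy

variable [DecidableEq ι]

lemma det_gram_ne_zero {r : Ω → ι → 𝕜} {x : κ → Ω}
    (h : ∀ c, (∀ j, r (x j) ⬝ᵥ c = 0) → c = 0) : (gram r x).det ≠ 0 := by
  intro h0
  obtain ⟨c, hc, hc0⟩ := exists_mulVec_eq_zero_iff.2 h0
  refine hc (h c fun j => ?_)
  have h1 := star_dotProduct_gram_mulVec r x c
  rw [hc0, dotProduct_zero, eq_comm, RCLike.ofReal_eq_zero,
    Finset.sum_eq_zero_iff_of_nonneg fun _ _ => by positivity] at h1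
  simpa using h1 j (Finset.mem_univ j)

/-- The perturbation factors through dimension two, so `det (1 + U W) = det (1 + W U)` reduces the
quotient of determinants to a `2 × 2` determinant. -/
lemma det_add_vecMulVec_sub {A : Matrix ι ι 𝕜} (hA : IsUnit A.det) (s r s' r' : ι → 𝕜) :
    (A + (vecMulVec s r - vecMulVec s' r')).det = A.det *
      ((1 + r ⬝ᵥ A⁻¹ *ᵥ s) * (1 - r' ⬝ᵥ A⁻¹ *ᵥ s') + (r ⬝ᵥ A⁻¹ *ᵥ s') * (r' ⬝ᵥ A⁻¹ *ᵥ s)) := by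
  let U : Matrix ι (Fin 2) 𝕜 := of fun i k => ![s, -s'] k i
  let W : Matrix (Fin 2) ι 𝕜 := of ![r, r']
  have h1 : vecMulVec s r - vecMulVec s' r' = U * W := by
    ext i j
    simp [U, W, Matrix.mul_apply, vecMulVec_apply, sub_eq_add_neg]
  have h2 : A + U * W = A * (1 + A⁻¹ * U * W) := by
    rw [Matrix.mul_add, Matrix.mul_one, ← Matrix.mul_assoc, ← Matrix.mul_assoc,
      mul_nonsing_inv _ hA, Matrix.one_mul]
  have h3 : ∀ k l, (W * (A⁻¹ * U)) k l = ![r, r'] k ⬝ᵥ A⁻¹ *ᵥ (![s, -s'] l) :=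
    fun k l => rfl
  rw [h1, h2, det_mul, det_one_add_mul_comm, det_fin_two]
  simp only [Matrix.add_apply, h3]
  simp [mulVec_neg, dotProduct_neg, -mul_eq_mul_left_iff]
  ring

/-- If a design maximizes the determinant of the Gram matrix, then the sum of squares at its points
controls the value at every other point. -/
lemma norm_sq_le_of_maximal_det {r : Ω → ι → 𝕜} {x : κ → Ω} (hdet : (gram r x).det ≠ 0)
    (hmax : ∀ x' : κ → Ω, ‖(gram r x').det‖ ≤ ‖(gram r x).det‖)
    (hcard : 2 * Fintype.card ι ≤ Fintype.card κ) (y : Ω) (c : ι → 𝕜) :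
    ‖r y ⬝ᵥ c‖ ^ 2 ≤ ∑ j, ‖r (x j) ⬝ᵥ c‖ ^ 2 := by
  classical
  have hP := gram_posSemidef r x
  obtain ⟨A, hA⟩ : ∃ A, A = gram r x := ⟨_, rfl⟩
  have hAv : ∀ v, A *ᵥ v = ∑ j, (r (x j) ⬝ᵥ v) • star (r (x j)) := fun v => by
    simp_rw [hA, gram, sum_mulVec, vecMulVec_mulVec]
    simp
  have hAt : ∀ B, (B * A).trace = ∑ j, r (x j) ⬝ᵥ B *ᵥ star (r (x j)) := fun B => by
    rw [hA, gram, Finset.mul_sum, trace_sum]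
    exact Finset.sum_congr rfl fun j _ => by rw [mul_vecMulVec, trace_vecMulVec, dotProduct_comm]
  have hst : ∀ z : 𝕜, z * star z = ((‖z‖ ^ 2 : ℝ) : 𝕜) := fun z => by
    rw [← starRingEnd_apply, RCLike.mul_conj]
    push_cast
    rfl
  rw [← hA] at hdet hmax hP
  have hu : IsUnit A.det := isUnit_iff_ne_zero.2 hdet
  have hPi : A⁻¹.PosSemidef := hP.inv
  have hherm : ∀ u v : ι → 𝕜, star (u ⬝ᵥ A⁻¹ *ᵥ star v) = v ⬝ᵥ A⁻¹ *ᵥ star u := fun u v => by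
    rw [← star_dotProduct_star, star_mulVec, star_star, hPi.1.eq, ← dotProduct_mulVec]
  have hrep : ∀ v : ι → 𝕜, r y ⬝ᵥ v = ∑ j, (r y ⬝ᵥ A⁻¹ *ᵥ star (r (x j))) * (r (x j) ⬝ᵥ v) := by
    intro v
    conv_lhs => rw [← one_mulVec v, ← nonsing_inv_mul A hu, ← mulVec_mulVec]
    rw [hAv, mulVec_sum, dotProduct_sum]
    refine Finset.sum_congr rfl fun j _ => ?_
    rw [mulVec_smul, dotProduct_smul, smul_eq_mul, mul_comm]
  -- `K` consists of the values at `y` and the design points of the reproducing kernel for the inner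
  -- product given by sampling. Its squared norm is the diagonal value `h`, so Cauchy–Schwarz
  -- reduces the claim to `h ≤ 1`.
  set K : κ → 𝕜 := fun j => r y ⬝ᵥ A⁻¹ *ᵥ star (r (x j)) with hK
  obtain ⟨h0, hy⟩ := hPi.dotProduct_mulVec_star_eq (r y)
  set h := RCLike.re (r y ⬝ᵥ A⁻¹ *ᵥ star (r y)) with hh
  have hsum : ∑ j, ‖K j‖ ^ 2 = h := by
    have := hrep (A⁻¹ *ᵥ star (r y))
    rw [hy] at this
    have e : ∀ j, (r y ⬝ᵥ A⁻¹ *ᵥ star (r (x j))) * (r (x j) ⬝ᵥ A⁻¹ *ᵥ star (r y)) =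
        ((‖K j‖ ^ 2 : ℝ) : 𝕜) := fun j => by
      rw [← hherm (r y), hst]
    simp_rw [e] at this
    exact_mod_cast this.symm
  have htr : ∑ j, RCLike.re (r (x j) ⬝ᵥ A⁻¹ *ᵥ star (r (x j))) = Fintype.card ι := by
    have := hAt A⁻¹
    rw [nonsing_inv_mul A hu, trace_one] at this
    rw [← map_sum, ← this]
    simp
  -- Replacing the point `x j` by `y` multiplies the determinant by the left side, which maximality
  -- bounds by `1`.
  have hex : ∀ j, (1 + h) * (1 - RCLike.re (r (x j) ⬝ᵥ A⁻¹ *ᵥ star (r (x j)))) + ‖K j‖ ^ 2 ≤ 1 := by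
    intro j
    have h1 := hmax (Function.update x j y)
    rw [gram_update, ← hA, det_add_vecMulVec_sub hu, norm_mul] at h1
    have h2 := le_of_mul_le_mul_left (h1.trans_eq (mul_one _).symm) (norm_pos_iff.2 hdet)
    rw [hy, (hPi.dotProduct_mulVec_star_eq (r (x j))).2, ← hherm (r y)] at h2
    refine (le_trans (le_of_eq ?_) (RCLike.re_le_norm _)).trans h2
    rw [hst]
    norm_cast
  -- With `n = card ι` and `k = card κ`, summing over `j` gives `(1 + h) (k - n) + h ≤ k`, that is
  -- `h ≤ n / (k - n + 1)`, and this is less than `1` when `k ≥ 2 n`.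
  have h1 : h ≤ 1 := by
    have h2 := Finset.sum_le_sum fun j (_ : j ∈ Finset.univ) => hex j
    rw [Finset.sum_add_distrib, ← Finset.mul_sum, Finset.sum_sub_distrib, htr, hsum] at h2
    simp only [Finset.sum_const, Finset.card_univ, nsmul_eq_mul, mul_one] at h2
    have h3 : (2 * Fintype.card ι : ℝ) ≤ Fintype.card κ := by exact_mod_cast hcard
    by_contra! h4
    nlinarith
  rw [hrep c]
  calc ‖∑ j, K j * (r (x j) ⬝ᵥ c)‖ ^ 2 ≤ (∑ j, ‖K j‖ * ‖r (x j) ⬝ᵥ c‖) ^ 2 := by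
        gcongr
        exact (norm_sum_le _ _).trans_eq (Finset.sum_congr rfl fun j _ => norm_mul _ _)
    _ ≤ (∑ j, ‖K j‖ ^ 2) * ∑ j, ‖r (x j) ⬝ᵥ c‖ ^ 2 := Finset.sum_mul_sq_le_sq_mul_sq _ _ _
    _ ≤ 1 * ∑ j, ‖r (x j) ⬝ᵥ c‖ ^ 2 := by
        rw [hsum]
        gcongr
    _ = _ := one_mul _

/-- **Optimal designs.** For an `n`-dimensional space of continuous functions on a compact
space and `k ≥ 2 n` there are `k` points such that the sum of squares at these points dominates the
square of the uniform norm. -/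
lemma exists_design [TopologicalSpace Ω] [CompactSpace Ω] [Nonempty Ω] {r : Ω → ι → 𝕜}
    (hcont : Continuous r) (hr : ∀ c, (∀ y, r y ⬝ᵥ c = 0) → c = 0) {k : ℕ}
    (hk : 2 * Fintype.card ι ≤ k) :
    ∃ x : Fin k → Ω, ∀ y c, ‖r y ⬝ᵥ c‖ ^ 2 ≤ ∑ j, ‖r (x j) ⬝ᵥ c‖ ^ 2 := by
  have hg : Continuous fun x : Fin k → Ω => ‖(gram r x).det‖ := by
    refine (Continuous.matrix_det ?_).norm
    refine continuous_finsetSum _ fun j _ => Continuous.matrix_vecMulVec ?_ ?_ <;> fun_prop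
  obtain ⟨x, -, hx⟩ := isCompact_univ.exists_isMaxOn Set.univ_nonempty hg.continuousOn
  obtain ⟨x₀, hx₀⟩ := exists_points_separating hr (by lia : Fintype.card ι ≤ k)
  have hmax : ∀ x' : Fin k → Ω, ‖(gram r x').det‖ ≤ ‖(gram r x).det‖ :=
    fun x' => hx (Set.mem_univ x')
  refine ⟨x, fun y c => norm_sq_le_of_maximal_det ?_ hmax (by simpa using hk) y c⟩
  exact norm_pos_iff.1 ((norm_pos_iff.2 (det_gram_ne_zero hx₀)).trans_le (hmax x₀))

end Design

/-! ### Discretization of two norms, and least squares. -/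

section Discretization

variable {𝕜 Ω : Type*} [RCLike 𝕜] [TopologicalSpace Ω] [CompactSpace Ω]

lemma integrable_of_continuous [MeasurableSpace Ω] [OpensMeasurableSpace Ω] (ν : Measure Ω)
    [IsFiniteMeasure ν] {f : Ω → 𝕜} (hf : Continuous f) : Integrable f ν := by
  obtain ⟨B, hB⟩ := isCompact_univ.exists_bound_of_continuousOn hf.continuousOn
  exact Integrable.of_bound hf.aestronglyMeasurable B (ae_of_all _ fun x => hB x (Set.mem_univ x))

lemma star_dotProduct_integral_mulVec {ι : Type*} [Fintype ι] [MeasurableSpace Ω]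
    [OpensMeasurableSpace Ω] (ν : Measure Ω) [IsFiniteMeasure ν] {r : Ω → ι → 𝕜}
    (hr : Continuous r) (c : ι → 𝕜) :
    star c ⬝ᵥ (of fun i j => ∫ x, star (r x i) * r x j ∂ν) *ᵥ c =
      ((∫ x, ‖r x ⬝ᵥ c‖ ^ 2 ∂ν : ℝ) : 𝕜) := by
  have hI : ∀ i j, Integrable (fun x => star (c i) * (star (r x i) * r x j * c j)) ν :=
    fun i j => integrable_of_continuous ν (by fun_prop)
  have e : ∀ x, ((‖r x ⬝ᵥ c‖ ^ 2 : ℝ) : 𝕜) =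
      ∑ i, ∑ j, star (c i) * (star (r x i) * r x j * c j) := by
    intro x
    push_cast
    rw [← RCLike.conj_mul]
    simp only [dotProduct, map_sum, Finset.sum_mul_sum, starRingEnd_apply, star_mul]
    exact Finset.sum_congr rfl fun i _ => Finset.sum_congr rfl fun j _ => by ring
  rw [← integral_ofReal]
  simp_rw [e]
  rw [integral_finsetSum _ fun i _ => integrable_finsetSum _ fun j _ => hI i j]
  refine Finset.sum_congr rfl fun i _ => ?_
  rw [integral_finsetSum _ fun j _ => hI i j, mulVec, dotProduct, Finset.mul_sum]
  refine Finset.sum_congr rfl fun j _ => ?_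
  rw [integral_const_mul, integral_mul_const]
  rfl

/-- Points at which the sum of squares dominates the uniform norm and the norm of `L²(μ)` on a
space of continuous functions of dimension at most `N`. -/
lemma exists_discretization [MeasurableSpace Ω] [BorelSpace Ω] (μ : Measure Ω)
    [IsProbabilityMeasure μ] (X : Submodule 𝕜 C(Ω, 𝕜)) [FiniteDimensional 𝕜 X] {N : ℕ}
    (hN : 1 ≤ N) (hX : Module.finrank 𝕜 X ≤ N) :
    ∃ x : Fin (6 * N) → Ω, ∀ u ∈ X, (∀ y, ‖u y‖ ^ 2 ≤ 4 * ∑ j, ‖u (x j)‖ ^ 2) ∧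
      N * ∫ y, ‖u y‖ ^ 2 ∂μ ≤ 2 * ∑ j, ‖u (x j)‖ ^ 2 := by
  have : Nonempty Ω := nonempty_of_isProbabilityMeasure μ
  have hN0 : (0 : ℝ) < N := by exact_mod_cast hN
  let b := Module.finBasis 𝕜 X
  let r : Ω → Fin (Module.finrank 𝕜 X) → 𝕜 := fun y i => (b i : C(Ω, 𝕜)) y
  have hr : Continuous r := continuous_pi fun i => (b i : C(Ω, 𝕜)).continuous
  have hu : ∀ (c : Fin (Module.finrank 𝕜 X) → 𝕜) (y : Ω),
      ((∑ i, c i • b i : X) : C(Ω, 𝕜)) y = r y ⬝ᵥ c := by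
    intro c y
    simp [r, dotProduct, mul_comm]
  have hinj : ∀ c, (∀ y, r y ⬝ᵥ c = 0) → c = 0 := by
    intro c hc
    have h0 : (∑ i, c i • b i : X) = 0 := by
      ext y
      rw [hu, hc]
      rfl
    funext i
    exact Fintype.linearIndependent_iff.1 b.linearIndependent c h0 i
  obtain ⟨z, hz⟩ := exists_design hr hinj (k := 2 * N) (by simpa using hX)
  -- The `2 N` atoms of weight `1 / (4 N)` carry half of the mass, and `μ` the other half.
  let ν : Measure Ω := (2 : ℝ≥0∞)⁻¹ • μ + (4 * N : ℝ≥0∞)⁻¹ • ∑ j, Measure.dirac (z j)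
  have hN4 : (4 * N : ℝ≥0∞) ≠ 0 := by
    simp; lia
  have hN4' : (4 * N : ℝ≥0∞) ≠ ∞ := by finiteness
  have hνp : IsProbabilityMeasure ν := by
    constructor
    simp only [ν, Measure.add_apply, Measure.smul_apply, measure_univ, Measure.finsetSum_apply,
      Finset.sum_const, Finset.card_univ, Fintype.card_fin, smul_eq_mul, mul_one, nsmul_eq_mul]
    have : ((2 * N : ℕ) : ℝ≥0∞) = 2⁻¹ * (4 * N) := by
      rw [← mul_assoc, show (4 : ℝ≥0∞) = 2 * 2 by norm_num, ← mul_assoc,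
        ENNReal.inv_mul_cancel (by simp) (by simp)]
      push_cast
      ring
    rw [this, mul_left_comm, ENNReal.inv_mul_cancel hN4 hN4', mul_one, ENNReal.inv_two_add_inv_two]
  have hint : ∀ c : Fin (Module.finrank 𝕜 X) → 𝕜, ∫ y, ‖r y ⬝ᵥ c‖ ^ 2 ∂ν =
      1 / 2 * ∫ y, ‖r y ⬝ᵥ c‖ ^ 2 ∂μ + 1 / (4 * N) * ∑ j, ‖r (z j) ⬝ᵥ c‖ ^ 2 := by
    intro c
    have hc : Continuous fun y => ‖r y ⬝ᵥ c‖ ^ 2 := by fun_prop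
    have hm : StronglyMeasurable fun y => ‖r y ⬝ᵥ c‖ ^ 2 := hc.stronglyMeasurable
    have hi : ∀ (ν' : Measure Ω) [IsFiniteMeasure ν'], Integrable (fun y => ‖r y ⬝ᵥ c‖ ^ 2) ν' :=
      fun ν' _ => integrable_of_continuous (𝕜 := ℝ) ν' hc
    have hi1 : Integrable (fun y => ‖r y ⬝ᵥ c‖ ^ 2) ((2 : ℝ≥0∞)⁻¹ • μ) :=
      (hi μ).smul_measure (by simp)
    have hi2 : Integrable (fun y => ‖r y ⬝ᵥ c‖ ^ 2)
        ((4 * N : ℝ≥0∞)⁻¹ • ∑ j, Measure.dirac (z j)) :=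
      (hi _).smul_measure (ENNReal.inv_ne_top.2 hN4)
    rw [integral_add_measure hi1 hi2, integral_smul_measure, integral_smul_measure,
      integral_finsetSum_measure fun j _ => hi _]
    simp_rw [integral_dirac' _ _ hm]
    simp
  -- The atoms alone give this bound. It also makes the Gram matrix in `L²(ν)` positive definite,
  -- even where `μ` does not separate the elements of `X`.
  have hlow : ∀ c y, ‖r y ⬝ᵥ c‖ ^ 2 ≤ 4 * N * ∫ y, ‖r y ⬝ᵥ c‖ ^ 2 ∂ν := by
    intro c y
    rw [hint, mul_add, ← mul_assoc _ (1 / (4 * N : ℝ)), mul_one_div_cancel (by positivity), one_mul]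
    have : 0 ≤ ∫ y, ‖r y ⬝ᵥ c‖ ^ 2 ∂μ := integral_nonneg fun _ => by positivity
    have := hz y c
    have : (0 : ℝ) ≤ 4 * N * (1 / 2 * ∫ y, ‖r y ⬝ᵥ c‖ ^ 2 ∂μ) := by positivity
    linarith
  have hG : (of fun i j => ∫ x, star (r x i) * r x j ∂ν).PosDef := by
    refine PosDef.of_dotProduct_mulVec_pos ?_ fun {c} hc => ?_
    · ext i j
      simp only [conjTranspose_apply, of_apply]
      rw [← starRingEnd_apply, ← integral_conj]
      simp [mul_comm]
    · rw [star_dotProduct_integral_mulVec ν hr c]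
      obtain ⟨y, hy⟩ : ∃ y, r y ⬝ᵥ c ≠ 0 := by
        by_contra! h
        exact hc (hinj c h)
      have h1 : 0 < ‖r y ⬝ᵥ c‖ ^ 2 := by positivity
      have h2 := pos_of_mul_pos_right (h1.trans_le (hlow c y)) (by positivity)
      exact_mod_cast h2
  obtain ⟨x, hx⟩ := exists_lower_frame hG
    (fun i j => integrable_of_continuous ν (by fun_prop)) (fun i j => rfl) hN (by simpa using hX)
  refine ⟨x, fun u huX => ?_⟩
  obtain ⟨c, hc⟩ : ∃ c : Fin (Module.finrank 𝕜 X) → 𝕜, ∀ y, u y = r y ⬝ᵥ c :=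
    ⟨b.repr ⟨u, huX⟩, fun y => by rw [← hu, b.sum_repr]⟩
  simp_rw [hc]
  have h := hx c
  rw [star_dotProduct_integral_mulVec ν hr c, RCLike.ofReal_re] at h
  refine ⟨fun y => by linarith [hlow c y], ?_⟩
  rw [hint] at h
  have : (0 : ℝ) ≤ N * (1 / (4 * N) * ∑ j, ‖r (z j) ⬝ᵥ c‖ ^ 2) := by positivity
  linarith

/-- If the values at the points `x j` determine the elements of `X`, then least squares on `X` is a
well-defined linear map, which is nonexpansive on the samples. -/
lemma exists_isLeastSquares (X : Submodule 𝕜 C(Ω, 𝕜)) {k : ℕ} {x : Fin k → Ω}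
    (hx : ∀ u ∈ X, (∀ j, u (x j) = 0) → u = 0) :
    ∃ T : (Fin k → 𝕜) →ₗ[𝕜] C(Ω, 𝕜), IsLeastSquares X x T ∧
      ∀ y, ∑ j, ‖T y (x j)‖ ^ 2 ≤ ∑ j, ‖y j‖ ^ 2 := by
  let S : C(Ω, 𝕜) →ₗ[𝕜] EuclideanSpace 𝕜 (Fin k) :=
    (WithLp.linearEquiv 2 𝕜 (Fin k → 𝕜)).symm.toLinearMap ∘ₗ
      LinearMap.pi fun j => (ContinuousMap.evalCLM 𝕜 (x j)).toLinearMap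
  have hS : ∀ u j, S u j = u (x j) := fun u j => rfl
  let ev : X →ₗ[𝕜] EuclideanSpace 𝕜 (Fin k) := S ∘ₗ X.subtype
  have hinj : Function.Injective ev := by
    rw [← LinearMap.ker_eq_bot, LinearMap.ker_eq_bot']
    intro u hu
    refine Subtype.ext (hx u u.2 fun j => ?_)
    rw [← hS]
    exact congrArg (fun v : EuclideanSpace 𝕜 (Fin k) => v j) hu
  let W := LinearMap.range ev
  let T : (Fin k → 𝕜) →ₗ[𝕜] C(Ω, 𝕜) := X.subtype ∘ₗ
    (LinearEquiv.ofInjective ev hinj).symm.toLinearMap ∘ₗ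
      W.orthogonalProjectionOnto.toLinearMap ∘ₗ (WithLp.linearEquiv 2 𝕜 (Fin k → 𝕜)).symm.toLinearMap
  have hT : ∀ y, S (T y) = W.starProjection (WithLp.toLp 2 y) := fun y =>
    congrArg Subtype.val ((LinearEquiv.ofInjective ev hinj).apply_symm_apply
      (W.orthogonalProjectionOnto (WithLp.toLp 2 y)))
  have hTX : ∀ y, T y ∈ X := fun y => Subtype.prop _
  have hsq : ∀ v : EuclideanSpace 𝕜 (Fin k), ∑ j, ‖v j‖ ^ 2 = ‖v‖ ^ 2 := fun v =>
    (EuclideanSpace.norm_sq_eq v).symm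
  have hsub : ∀ (y : Fin k → 𝕜) u, ∑ j, ‖y j - u (x j)‖ ^ 2 = ‖WithLp.toLp 2 y - S u‖ ^ 2 :=
    fun y u => hsq (WithLp.toLp 2 y - S u)
  refine ⟨T, fun y => ⟨hTX y, fun v hv hne => ?_⟩, fun y => ?_⟩
  · rw [hsub, hsub]
    have hd : S (T y) - S v ∈ W := ⟨⟨T y - v, X.sub_mem (hTX y) hv⟩, map_sub S _ _⟩
    -- Pythagoras: the residual of any other `v` in `X` exceeds the residual of the projection by
    -- the nonzero vector `S (T y) - S v` of `W`, which gives both minimality and uniqueness.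
    have horth := W.sub_starProjection_mem_orthogonal (WithLp.toLp 2 y)
    rw [← hT] at horth
    have h0 : S (T y) - S v ≠ 0 := by
      intro h
      have : ev ⟨T y, hTX y⟩ = ev ⟨v, hv⟩ := sub_eq_zero.1 h
      exact hne (congrArg Subtype.val (hinj this)).symm
    have h1 := norm_add_sq_eq_norm_sq_add_norm_sq_of_inner_eq_zero (𝕜 := 𝕜) _ _
      (W.inner_left_of_mem_orthogonal hd horth)
    rw [sub_add_sub_cancel] at h1
    have := norm_pos_iff.2 h0
    nlinarith
  · have h1 := W.norm_starProjection_apply_le (WithLp.toLp 2 y)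
    rw [← hT] at h1
    calc ∑ j, ‖T y (x j)‖ ^ 2 = ‖S (T y)‖ ^ 2 := hsq (S (T y))
      _ ≤ ‖WithLp.toLp 2 y‖ ^ 2 := by gcongr
      _ = _ := (hsq _).symm

end Discretization

/-! ### Growth of `Φ` on `[0, √N]`. -/

section Growth

variable {Φ : ℝ≥0 → ℝ≥0} {p : ℝ} {a : ℝ≥0}

lemma AIncWith.map_mul_le (h : AIncWith Φ p a) (hΦ : IsPhiFunction Φ) {θ : ℝ≥0}
    (hθ : θ ≤ 1) (s : ℝ≥0) : Φ (θ * s) ≤ a * θ ^ p * Φ s := by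
  rcases eq_or_ne s 0 with rfl | hs
  · simp [hΦ.map_zero]
  rcases eq_or_ne θ 0 with rfl | hθ0
  · simp [hΦ.map_zero]
  rcases hθ.eq_or_lt with rfl | hlt
  · simpa using le_mul_of_one_le_left (zero_le (a := Φ s)) h.1
  · have hs' : 0 < s := pos_iff_ne_zero.2 hs
    have hθ' : 0 < θ := pos_iff_ne_zero.2 hθ0
    have h1 := h.2 (θ * s) s (mul_pos hθ' hs') (mul_lt_of_lt_one_left hs' hlt)
    rw [div_le_iff₀ (NNReal.rpow_pos (mul_pos hθ' hs')), NNReal.mul_rpow] at h1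
    refine h1.trans_eq ?_
    have : s ^ p ≠ 0 := (NNReal.rpow_pos hs').ne'
    field_simp

/-- The factor by which the recovery error in `L^Φ` exceeds the uniform error of approximation, up
to the quasi-triangle constant. -/
noncomputable def errorFactor (Φ : ℝ≥0 → ℝ≥0) (p : ℝ) (a : ℝ≥0) (N : ℕ) : ℝ≥0 :=
  a ^ (2 / p) * (1 + (Φ 1)⁻¹) ^ (1 / p) * rate Φ p N

lemma errorFactor_rpow (hp : 0 < p) (N : ℕ) :
    errorFactor Φ p a N ^ p = a ^ 2 * (1 + (Φ 1)⁻¹) * (Φ (NNReal.sqrt N) / N) := by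
  unfold errorFactor rate
  rw [NNReal.mul_rpow, NNReal.mul_rpow, ← NNReal.rpow_mul, ← NNReal.rpow_mul, ← NNReal.rpow_mul,
    div_mul_cancel₀ _ hp.ne', div_mul_cancel₀ _ hp.ne', NNReal.rpow_one, NNReal.rpow_one]
  norm_cast

variable {N : ℕ}

/-- Compare `s` with the endpoint `√N`; as `s / √N ≤ 1` and `p ≥ 2`, the power `p` of this ratio is
at most its square. -/
lemma AIncWith.map_le_sq (h : AIncWith Φ p a) (hΦ : IsPhiFunction Φ) (hp : 2 ≤ p) (hN : 1 ≤ N)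
    {s : ℝ≥0} (hs : s ≤ NNReal.sqrt N) : Φ s ≤ a * (Φ (NNReal.sqrt N) / N) * s ^ 2 := by
  have hN0 : (N : ℝ≥0) ≠ 0 := by simp; lia
  have hq0 : 0 < NNReal.sqrt N := NNReal.sqrt_pos.2 (pos_iff_ne_zero.2 hN0)
  have hθ : s / NNReal.sqrt N ≤ 1 := (div_le_one hq0).2 hs
  calc Φ s = Φ (s / NNReal.sqrt N * NNReal.sqrt N) := by rw [div_mul_cancel₀ _ hq0.ne']
    _ ≤ a * (s / NNReal.sqrt N) ^ p * Φ (NNReal.sqrt N) :=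
        h.map_mul_le hΦ hθ _
    _ ≤ a * (s / NNReal.sqrt N) ^ (2 : ℝ) * Φ (NNReal.sqrt N) := by
        gcongr a * ?_ * _
        exact_mod_cast Real.rpow_le_rpow_of_exponent_ge' (s / NNReal.sqrt N).coe_nonneg
          (by exact_mod_cast hθ) zero_le_two hp
    _ = _ := by
        rw [NNReal.rpow_two, div_pow, NNReal.sq_sqrt]
        field_simp

/-- The case `s = 1` of `AIncWith.map_le_sq` bounds `Φ(√N) / N` below by `Φ(1) / a`, and the summand
`Φ(1)⁻¹` compensates for `Φ(1)`. The bound permits division by `errorFactor` in `(aInc)_p`. -/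
lemma AIncWith.one_le_errorFactor (h : AIncWith Φ p a) (hΦ : IsPhiFunction Φ) (hp : 2 ≤ p)
    (h1 : 0 < Φ 1) (hN : 1 ≤ N) : 1 ≤ errorFactor Φ p a N := by
  have hp0 : 0 < p := by linarith
  rw [← NNReal.rpow_le_rpow_iff hp0, NNReal.one_rpow, errorFactor_rpow hp0]
  have h2 : Φ 1 ≤ a * (Φ (NNReal.sqrt N) / N) := by
    simpa using h.map_le_sq hΦ hp hN (s := 1) (by simpa using hN)
  calc (1 : ℝ≥0) = (Φ 1)⁻¹ * Φ 1 := (inv_mul_cancel₀ h1.ne').symm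
    _ ≤ (1 + (Φ 1)⁻¹) * (a * (a * (Φ (NNReal.sqrt N) / N))) := by
        refine mul_le_mul' (le_add_of_nonneg_left zero_le_one) (h2.trans ?_)
        exact le_mul_of_one_le_left zero_le h.1
    _ = _ := by ring

/-- `(aInc)_p` is used twice, for the division by `errorFactor` and for the comparison with `√N`;
hence the power `a ^ (2 / p)`. -/
lemma AIncWith.map_div_errorFactor_le (h : AIncWith Φ p a) (hΦ : IsPhiFunction Φ) (hp : 2 ≤ p)
    (h1 : 0 < Φ 1) (hN : 1 ≤ N) {s : ℝ≥0} (hs : s ≤ NNReal.sqrt N) :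
    Φ (s / errorFactor Φ p a N) ≤ s ^ 2 := by
  have hp0 : 0 < p := by linarith
  have hB := h.one_le_errorFactor hΦ hp h1 hN
  have hB0 : 0 < errorFactor Φ p a N ^ p := NNReal.rpow_pos (by positivity)
  calc Φ (s / errorFactor Φ p a N) = Φ ((errorFactor Φ p a N)⁻¹ * s) := by rw [div_eq_inv_mul]
    _ ≤ a * (errorFactor Φ p a N)⁻¹ ^ p * Φ s := h.map_mul_le hΦ (inv_le_one_of_one_le₀ hB) s
    _ ≤ a * (errorFactor Φ p a N)⁻¹ ^ p * (a * (Φ (NNReal.sqrt N) / N) * s ^ 2) := by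
        gcongr
        exact h.map_le_sq hΦ hp hN hs
    _ = (errorFactor Φ p a N ^ p)⁻¹ * (a ^ 2 * 1 * (Φ (NNReal.sqrt N) / N)) * s ^ 2 := by
        rw [NNReal.inv_rpow]
        ring
    _ ≤ (errorFactor Φ p a N ^ p)⁻¹ * errorFactor Φ p a N ^ p * s ^ 2 := by
        rw [errorFactor_rpow hp0]
        gcongr
        exact le_self_add
    _ = s ^ 2 := by rw [inv_mul_cancel₀ hB0.ne', one_mul]

end Growth

/-! ### The Luxemburg functional and its quasi-triangle inequality. -/

section Norm

variable {𝕜 Ω : Type*} [RCLike 𝕜] [MeasurableSpace Ω]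
  {Φ : ℝ≥0 → ℝ≥0} {p : ℝ} {a : ℝ≥0} {N : ℕ} {μ : Measure Ω}

lemma luxNorm_le {f : Ω → 𝕜} {l : ℝ≥0} (hl : 0 < l) (h : modular Φ μ f l ≤ 1) :
    luxNorm Φ μ f ≤ l :=
  iInf₂_le l ⟨hl, h⟩

lemma luxNorm_zero (hΦ : IsPhiFunction Φ) : luxNorm Φ μ (0 : Ω → 𝕜) = 0 := by
  refine le_antisymm (ENNReal.le_of_forall_pos_le_add fun ε hε _ => ?_) zero_le
  rw [zero_add]
  exact luxNorm_le hε (by simp [modular, hΦ.map_zero])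

/-- A function with values at most `t √N` and norm at most `t` in `L²(μ)` has norm at most
`errorFactor Φ p a N * t` in `L^Φ(μ)`. -/
lemma AIncWith.luxNorm_le_of_lintegral_sq_le (h : AIncWith Φ p a) (hΦ : IsPhiFunction Φ)
    (hp : 2 ≤ p) (h1 : 0 < Φ 1) (hN : 1 ≤ N) {f : Ω → 𝕜} {t : ℝ≥0} (ht : 0 < t)
    (hf : ∀ x, ‖f x‖₊ ≤ t * NNReal.sqrt N) (hf2 : ∫⁻ x, (‖f x‖₊ : ℝ≥0∞) ^ 2 ∂μ ≤ (t : ℝ≥0∞) ^ 2) :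
    luxNorm Φ μ f ≤ (errorFactor Φ p a N * t : ℝ≥0) := by
  have hB := h.one_le_errorFactor hΦ hp h1 hN
  refine luxNorm_le (by positivity) ?_
  have ht2 : ((t : ℝ≥0∞) ^ 2) ≠ 0 := by simpa using ht.ne'
  calc modular Φ μ f (errorFactor Φ p a N * t)
      ≤ ∫⁻ x, ((t : ℝ≥0∞) ^ 2)⁻¹ * (‖f x‖₊ : ℝ≥0∞) ^ 2 ∂μ := by
        refine lintegral_mono fun x => ?_
        have h2 : ‖f x‖₊ / t ≤ NNReal.sqrt N := by
          rw [div_le_iff₀ ht, mul_comm]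
          exact hf x
        have h3 := h.map_div_errorFactor_le hΦ hp h1 hN h2
        rw [div_div, mul_comm t, div_pow, div_eq_inv_mul (_ ^ 2)] at h3
        have ht3 : t ^ 2 ≠ 0 := by positivity
        rw [← ENNReal.coe_pow, ← ENNReal.coe_pow, ← ENNReal.coe_inv ht3, ← ENNReal.coe_mul]
        exact ENNReal.coe_le_coe.2 h3
    _ = ((t : ℝ≥0∞) ^ 2)⁻¹ * ∫⁻ x, (‖f x‖₊ : ℝ≥0∞) ^ 2 ∂μ :=
        lintegral_const_mul' _ _ (ENNReal.inv_ne_top.2 ht2)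
    _ ≤ ((t : ℝ≥0∞) ^ 2)⁻¹ * (t : ℝ≥0∞) ^ 2 := by gcongr
    _ = 1 := ENNReal.inv_mul_cancel ht2 (by finiteness)

lemma AIncWith.modular_mul_le (h : AIncWith Φ 1 a) (hΦ : IsPhiFunction Φ) (f : Ω → 𝕜)
    {l L : ℝ≥0} (hl : 0 < l) (hL : l ≤ L) : modular Φ μ f (2 * a * L) ≤ 2⁻¹ * modular Φ μ f l := by
  have ha : 0 < a := zero_lt_one.trans_le h.1
  rw [modular, modular, ← lintegral_const_mul' _ _ (by simp)]
  refine lintegral_mono fun x => ?_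
  have hθ : (2 * a)⁻¹ ≤ 1 := inv_le_one_of_one_le₀ (by
    calc (1 : ℝ≥0) ≤ 2 * 1 := by norm_num
      _ ≤ 2 * a := by gcongr; exact h.1)
  have h1 : Φ (‖f x‖₊ / (2 * a * L)) ≤ 2⁻¹ * Φ (‖f x‖₊ / l) :=
    calc Φ (‖f x‖₊ / (2 * a * L)) ≤ Φ ((2 * a)⁻¹ * (‖f x‖₊ / l)) := by
          refine hΦ.monotone ?_
          rw [← div_eq_inv_mul, div_div, mul_comm l]
          gcongr
      _ ≤ a * (2 * a)⁻¹ ^ (1 : ℝ) * Φ (‖f x‖₊ / l) := h.map_mul_le hΦ hθ _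
      _ = 2⁻¹ * Φ (‖f x‖₊ / l) := by
          rw [NNReal.rpow_one]
          congr 1
          field_simp
  have h2 : (2⁻¹ : ℝ≥0∞) = ((2⁻¹ : ℝ≥0) : ℝ≥0∞) := by
    rw [ENNReal.coe_inv two_ne_zero]
    rfl
  rw [h2, ← ENNReal.coe_mul]
  exact ENNReal.coe_le_coe.2 h1

/-- Since `|f + g| ≤ 2 max(|f|, |g|)` and `Φ` of a maximum is at most the sum, it is enough to make
both modulars at most `1 / 2`, which costs the factor `2 a`. The constant depends on `Φ` alone. -/
lemma AIncWith.isQuasiTriangleConst (h : AIncWith Φ 1 a) (hΦ : IsPhiFunction Φ) :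
    IsQuasiTriangleConst 𝕜 Φ μ (4 * a) := by
  have ha : 0 < a := zero_lt_one.trans_le h.1
  intro f g hf hg
  have key : ∀ l₁ : ℝ≥0, 0 < l₁ ∧ modular Φ μ f l₁ ≤ 1 → ∀ l₂ : ℝ≥0,
      0 < l₂ ∧ modular Φ μ g l₂ ≤ 1 →
      luxNorm Φ μ (f + g) ≤ ((4 * a : ℝ≥0) : ℝ≥0∞) * ((l₁ : ℝ≥0∞) + l₂) := by
    rintro l₁ ⟨hl₁, hf1⟩ l₂ ⟨hl₂, hg1⟩
    rw [← ENNReal.coe_add, ← ENNReal.coe_mul]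
    refine luxNorm_le (by positivity) ?_
    have hmeas : AEMeasurable (fun x => (Φ (‖f x‖₊ / (2 * a * (l₁ + l₂))) : ℝ≥0∞)) μ :=
      (hΦ.monotone.measurable.comp_aemeasurable 
        (hf.1.nnnorm.aemeasurable.div_const _)).coe_nnreal_ennreal
    calc modular Φ μ (f + g) (4 * a * (l₁ + l₂))
        ≤ ∫⁻ x, ((Φ (‖f x‖₊ / (2 * a * (l₁ + l₂))) : ℝ≥0∞) +
            Φ (‖g x‖₊ / (2 * a * (l₁ + l₂)))) ∂μ := by
          refine lintegral_mono fun x => ?_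
          have h1 : ‖(f + g) x‖₊ / (4 * a * (l₁ + l₂)) ≤
              max (‖f x‖₊ / (2 * a * (l₁ + l₂))) (‖g x‖₊ / (2 * a * (l₁ + l₂))) := by
            rw [max_div_div_right zero_le]
            calc ‖(f + g) x‖₊ / (4 * a * (l₁ + l₂)) ≤
                (2 * max ‖f x‖₊ ‖g x‖₊) / (2 * (2 * a * (l₁ + l₂))) := by
                  have : 4 * a * (l₁ + l₂) = 2 * (2 * a * (l₁ + l₂)) := by ring
                  rw [this]
                  gcongr
                  rw [two_mul]
                  exact (nnnorm_add_le _ _).trans (add_le_add (le_max_left _ _) (le_max_right _ _))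
              _ = _ := mul_div_mul_left _ _ two_ne_zero
          rw [← ENNReal.coe_add]
          refine ENNReal.coe_le_coe.2 ((hΦ.monotone h1).trans ?_)
          rw [hΦ.monotone.map_max]
          exact max_le le_self_add le_add_self
      _ = modular Φ μ f (2 * a * (l₁ + l₂)) + modular Φ μ g (2 * a * (l₁ + l₂)) :=
          lintegral_add_left' hmeas _
      _ ≤ 2⁻¹ * modular Φ μ f l₁ + 2⁻¹ * modular Φ μ g l₂ :=
          add_le_add (h.modular_mul_le hΦ f hl₁ le_self_add) (h.modular_mul_le hΦ g hl₂ le_add_self)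
      _ ≤ 2⁻¹ * 1 + 2⁻¹ * 1 := by gcongr
      _ = 1 := by simp [ENNReal.inv_two_add_inv_two]
  have h0 : ((4 * a : ℝ≥0) : ℝ≥0∞) ≠ 0 := by simpa using ha.ne'
  rw [luxNorm.eq_def Φ μ f, luxNorm.eq_def Φ μ g]
  simp only [ENNReal.iInf_add, ENNReal.add_iInf, ENNReal.mul_iInf_of_ne h0 ENNReal.coe_ne_top]
  exact le_iInf₂ fun l₂ h₂ => le_iInf₂ fun l₁ h₁ => key l₁ h₁ l₂ h₂

end Norm

/-! ### Recovery by least squares and sampling numbers. -/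

section Recovery

variable {𝕜 Ω : Type*} [RCLike 𝕜] [TopologicalSpace Ω] [CompactSpace Ω] [MeasurableSpace Ω]
  {Φ : ℝ≥0 → ℝ≥0} {p : ℝ} {a K : ℝ≥0} {N : ℕ} {μ : Measure Ω}

lemma memOrlicz_of_continuous [BorelSpace Ω] [IsFiniteMeasure μ] (hΦ : IsPhiFunction Φ)
    (f : C(Ω, 𝕜)) : MemOrlicz Φ μ f := by
  refine ⟨f.continuous.aestronglyMeasurable, 1, one_pos, ?_⟩
  calc modular Φ μ f 1 ≤ ∫⁻ _, (Φ ‖f‖₊ : ℝ≥0∞) ∂μ := by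
        refine lintegral_mono fun x => ENNReal.coe_le_coe.2 (hΦ.monotone ?_)
        rw [div_one]
        exact f.norm_coe_le_norm x
    _ < ∞ := by
        rw [lintegral_const]
        exact ENNReal.mul_lt_top ENNReal.coe_lt_top (measure_lt_top μ _)

/-- With `K = 0` the constant function `1` would have norm zero, which `Φ(t) → ∞` excludes.
Positivity lets the constant pass through infima in `[0, ∞]`. -/
lemma IsQuasiTriangleConst.pos [BorelSpace Ω] [IsProbabilityMeasure μ] (hΦ : IsPhiFunction Φ)
    (hK : IsQuasiTriangleConst 𝕜 Φ μ K) : 0 < K := by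
  refine pos_iff_ne_zero.2 fun h0 => ?_
  have h := hK _ _ (memOrlicz_of_continuous hΦ (1 : C(Ω, 𝕜)))
    (memOrlicz_of_continuous hΦ (0 : C(Ω, 𝕜)))
  rw [h0, ENNReal.coe_zero, zero_mul] at h
  obtain ⟨t, ht0, ht⟩ := ((eventually_gt_atTop 0).and
    (hΦ.tendsto_atTop.eventually_gt_atTop 1)).exists
  have hle : ((t⁻¹ : ℝ≥0) : ℝ≥0∞) ≤ luxNorm Φ μ (⇑(1 : C(Ω, 𝕜)) + ⇑(0 : C(Ω, 𝕜))) := by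
    refine le_iInf₂ fun l ⟨hl, hm⟩ => ENNReal.coe_le_coe.2 ?_
    by_contra! hlt
    have h1 : t ≤ 1 / l := by
      rw [one_div]
      exact (le_inv_comm₀ ht0 hl).2 hlt.le
    have h2 : (Φ (1 / l) : ℝ≥0∞) ≤ 1 := by simpa [modular] using hm
    exact (ht.trans_le (hΦ.monotone h1)).not_ge (by exact_mod_cast h2)
  exact ht0.ne' (by simpa using hle.trans h)

/-- On a space of continuous functions of dimension at most `N`, least squares at suitable points
is a linear recovery method whose error in `L^Φ(μ)` is controlled by the error of best uniform
approximation. -/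
lemma AIncWith.leastSquaresRecovers [BorelSpace Ω] [IsProbabilityMeasure μ]
    (h : AIncWith Φ p a) (hΦ : IsPhiFunction Φ) (hp : 2 ≤ p) (h1 : 0 < Φ 1) (hN : 1 ≤ N)
    (hK : IsQuasiTriangleConst 𝕜 Φ μ K) (X : Submodule 𝕜 C(Ω, 𝕜)) [FiniteDimensional 𝕜 X]
    (hX : Module.finrank 𝕜 X ≤ N) :
    LeastSquaresRecovers Φ μ X (6 * N) (6 * K * errorFactor Φ p a N) := by
  have hB := h.one_le_errorFactor hΦ hp h1 hN
  have hN1 : (1 : ℝ) ≤ N := by exact_mod_cast hN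
  obtain ⟨x, hx⟩ := exists_discretization μ X hN hX
  obtain ⟨T, hT, hTle⟩ := exists_isLeastSquares X (x := x) (fun u hu h0 => by
    ext y
    have := (hx u hu).1 y
    simp only [h0, norm_zero] at this
    have : ‖u y‖ ^ 2 = 0 := le_antisymm (by simpa using this) (by positivity)
    simpa using this)
  have hTX : ∀ u ∈ X, (T fun j => u (x j)) = u := by
    intro u hu
    by_contra hne
    have := (hT fun j => u (x j)).2 u hu (Ne.symm hne)
    simp only [sub_self, norm_zero] at this
    exact this.not_ge (by simpa using Finset.sum_nonneg fun _ _ => by positivity)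
  refine ⟨6 * N, le_rfl, x, T, hT, fun f => ?_⟩
  have hB0 : ((6 * K * errorFactor Φ p a N : ℝ≥0) : ℝ≥0∞) ≠ 0 := by
    have := hK.pos hΦ
    simp [this.ne', (zero_lt_one.trans_le hB).ne']
  unfold uniformDist
  simp only [ENNReal.mul_iInf_of_ne hB0 ENNReal.coe_ne_top]
  refine le_iInf₂ fun u hu => ?_
  set g := f - u with hg
  set v := T fun j => g (x j) with hv
  have hfg : ⇑f - ⇑(T fun j => f (x j)) = ⇑g + ⇑(-v) := by
    have : (fun j => f (x j)) = (fun j => g (x j)) + fun j => u (x j) := by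
      funext j
      simp [hg]
    rw [this, map_add, hTX u hu]
    funext y
    simp [hg, hv]
    ring
  rw [hfg]
  -- The norm estimate divides by `t = ‖g‖`, so `g = 0` is separate.
  rcases eq_or_ne g 0 with hg0 | hg0
  · have hv0 : v = 0 := by
      rw [hv, hg0]
      exact map_zero T
    rw [hg0, hv0, neg_zero, ContinuousMap.coe_zero, add_zero, luxNorm_zero hΦ]
    exact zero_le
  set t := ‖g‖₊ with ht
  have ht0 : 0 < t := nnnorm_pos.2 hg0
  have hgt : ∀ y, ‖g y‖₊ ≤ t := fun y => g.norm_coe_le_norm y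
  have h2 : luxNorm Φ μ g ≤ (errorFactor Φ p a N * t : ℝ≥0) := by
    refine h.luxNorm_le_of_lintegral_sq_le hΦ hp h1 hN ht0 (fun y => (hgt y).trans ?_) ?_
    · exact le_mul_of_one_le_right zero_le (by simpa using hN)
    · calc ∫⁻ y, (‖g y‖₊ : ℝ≥0∞) ^ 2 ∂μ ≤ ∫⁻ _, (t : ℝ≥0∞) ^ 2 ∂μ := by
            refine lintegral_mono fun y => ?_
            gcongr
            exact hgt y
        _ = (t : ℝ≥0∞) ^ 2 := by simp
  have hvX : -v ∈ X := X.neg_mem (hT _).1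
  have hsum : ∑ j, ‖(-v) (x j)‖ ^ 2 ≤ 6 * N * (t : ℝ) ^ 2 := by
    calc ∑ j, ‖(-v) (x j)‖ ^ 2 = ∑ j, ‖v (x j)‖ ^ 2 := by simp
      _ ≤ ∑ j, ‖g (x j)‖ ^ 2 := hTle _
      _ ≤ ∑ _j : Fin (6 * N), (t : ℝ) ^ 2 := by
          refine Finset.sum_le_sum fun j _ => ?_
          gcongr
          exact hgt (x j)
      _ = _ := by simp
  obtain ⟨hsup, hL2⟩ := hx _ hvX
  -- The discretization gives `|v|² ≤ 24 N t²` pointwise and `∫ |v|² ≤ 12 t²`; both are covered by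
  -- `5² = 25`. Together with `g` this yields the constant `1 + 5 = 6`.
  have h3 : luxNorm Φ μ ⇑(-v) ≤ (errorFactor Φ p a N * (5 * t) : ℝ≥0) := by
    refine h.luxNorm_le_of_lintegral_sq_le hΦ hp h1 hN (by positivity) (fun y => ?_) ?_
    · rw [← NNReal.coe_le_coe]
      push_cast
      refine (pow_le_pow_iff_left₀ (norm_nonneg _) (by positivity) two_ne_zero).1 ?_
      rw [mul_pow, Real.sq_sqrt (by positivity)]
      have := hsup y
      have : (0 : ℝ) ≤ N * t ^ 2 := by positivity
      nlinarith
    · have hint : Integrable (fun y => ‖(-v) y‖ ^ 2) μ :=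
        integrable_of_continuous (𝕜 := ℝ) μ (by fun_prop)
      have h4 : ∫ y, ‖(-v) y‖ ^ 2 ∂μ ≤ (5 * t : ℝ) ^ 2 := by
        have : N * ∫ y, ‖(-v) y‖ ^ 2 ∂μ ≤ N * (5 * t : ℝ) ^ 2 := by
          have : (0 : ℝ) ≤ N * t ^ 2 := by positivity
          nlinarith
        exact le_of_mul_le_mul_left this (by linarith)
      have h5 := ENNReal.ofReal_le_ofReal h4
      rw [ofReal_integral_eq_lintegral_ofReal hint (ae_of_all _ fun _ => by positivity)] at h5
      convert h5 using 1
      · refine lintegral_congr fun y => ?_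
        rw [ENNReal.ofReal_pow (norm_nonneg _), ofReal_norm]
        rfl
      · rw [ENNReal.ofReal_pow (by positivity), ← ENNReal.ofReal_coe_nnreal]
        push_cast
        rfl
  calc luxNorm Φ μ (⇑g + ⇑(-v)) ≤ K * (luxNorm Φ μ g + luxNorm Φ μ ⇑(-v)) :=
        hK _ _ (memOrlicz_of_continuous hΦ g) (memOrlicz_of_continuous hΦ (-v))
    _ ≤ K * ((errorFactor Φ p a N * t : ℝ≥0) + (errorFactor Φ p a N * (5 * t) : ℝ≥0)) := by gcongr
    _ = ((6 * K * errorFactor Φ p a N : ℝ≥0) : ℝ≥0∞) * t := by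
        push_cast
        ring

lemma LeastSquaresRecovers.mono {X : Submodule 𝕜 C(Ω, 𝕜)} {m : ℕ} {B B' : ℝ≥0} (hB : B ≤ B')
    (h : LeastSquaresRecovers Φ μ X m B) : LeastSquaresRecovers Φ μ X m B' := by
  obtain ⟨k, hk, x, T, hT, hf⟩ := h
  exact ⟨k, hk, x, T, hT, fun f => (hf f).trans (by gcongr)⟩

/-- Repeated points are merged into a finite set, and the samples on it are copied back to the
original list before `T` is applied. -/
lemma LeastSquaresRecovers.samplingNumber_le [BorelSpace Ω] [IsFiniteMeasure μ]
    (hΦ : IsPhiFunction Φ) {X : Submodule 𝕜 C(Ω, 𝕜)} {m : ℕ} {B : ℝ≥0}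
    (h : LeastSquaresRecovers Φ μ X m B) (F : Set C(Ω, 𝕜)) :
    samplingNumber Φ μ F m ≤ B * ⨆ f ∈ F, uniformDist f X := by
  classical
  obtain ⟨k, hk, x, T, -, hf⟩ := h
  let s : Finset Ω := Finset.univ.image x
  have hs : ∀ j, x j ∈ s := fun j => Finset.mem_image_of_mem x (Finset.mem_univ j)
  have hcard : s.card ≤ m := (Finset.card_image_le.trans (by simp)).trans hk
  let S : (s → 𝕜) →ₗ[𝕜] (Ω → 𝕜) := ContinuousMap.coeFnLinearMap 𝕜 ∘ₗ T ∘ₗ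
    LinearMap.funLeft 𝕜 𝕜 fun j => (⟨x j, hs j⟩ : s)
  refine iInf₂_le_of_le s hcard (iInf₂_le_of_le S (fun y => memOrlicz_of_continuous hΦ _) ?_)
  simp only [ENNReal.mul_iSup]
  exact iSup₂_mono fun f _ => hf f

lemma samplingNumber_le_mul_kolmogorovWidth [BorelSpace Ω] [IsFiniteMeasure μ]
    (hΦ : IsPhiFunction Φ) {m : ℕ} {B : ℝ≥0} (hB : B ≠ 0)
    (h : ∀ X : Submodule 𝕜 C(Ω, 𝕜), FiniteDimensional 𝕜 X → Module.finrank 𝕜 X ≤ N →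
      LeastSquaresRecovers Φ μ X m B) (F : Set C(Ω, 𝕜)) :
    samplingNumber Φ μ F m ≤ B * kolmogorovWidth F N := by
  unfold kolmogorovWidth
  simp only [ENNReal.mul_iInf_of_ne (ENNReal.coe_ne_zero.2 hB) ENNReal.coe_ne_top]
  exact le_iInf₂ fun X hX => (h X hX.1 hX.2).samplingNumber_le hΦ F

end Recovery

end Orlicz

/-! ### Assembly of the constants. -/

theorem theorem6p1 :
    ∃ c : ℕ, 1 ≤ c ∧ ∃ C : ℝ≥0, 1 ≤ C ∧
      ∀ (p : ℝ) (Φ : ℝ≥0 → ℝ≥0), 2 ≤ p → Orlicz.IsPhiFunction Φ → Orlicz.AInc Φ p → 0 < Φ 1 →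
        (∃ K : ℝ≥0, 1 ≤ K ∧
          ∀ (N : ℕ), 1 ≤ N →
          ∀ (𝕜 : Type) [RCLike 𝕜] (d : ℕ) (Ω : Set (EuclideanSpace ℝ (Fin d))) [CompactSpace Ω]
            (μ : Measure Ω) [IsProbabilityMeasure μ],
            (∀ F : Set C(Ω, 𝕜),
              Orlicz.samplingNumber Φ μ F (c * N) ≤
                (K * Orlicz.rate Φ p N : ℝ≥0) * Orlicz.kolmogorovWidth F N) ∧
            (∀ X : Submodule 𝕜 C(Ω, 𝕜), Module.finrank 𝕜 X = N →
              Orlicz.LeastSquaresRecovers Φ μ X (c * N) (K * Orlicz.rate Φ p N))) ∧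
        (∀ a : ℝ≥0, Orlicz.AIncWith Φ p a →
          ∀ (N : ℕ), 1 ≤ N →
          ∀ (𝕜 : Type) [RCLike 𝕜] (d : ℕ) (Ω : Set (EuclideanSpace ℝ (Fin d))) [CompactSpace Ω]
            (μ : Measure Ω) [IsProbabilityMeasure μ] (CΦ : ℝ≥0),
            Orlicz.IsQuasiTriangleConst 𝕜 Φ μ CΦ →
            (∀ F : Set C(Ω, 𝕜),
              Orlicz.samplingNumber Φ μ F (c * N) ≤
                (C * CΦ * a ^ (2 / p) * (1 + (Φ 1)⁻¹) ^ (1 / p) * Orlicz.rate Φ p N : ℝ≥0) *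
                  Orlicz.kolmogorovWidth F N) ∧
            (∀ X : Submodule 𝕜 C(Ω, 𝕜), Module.finrank 𝕜 X = N →
              Orlicz.LeastSquaresRecovers Φ μ X (c * N)
                (C * CΦ * a ^ (2 / p) * (1 + (Φ 1)⁻¹) ^ (1 / p) * Orlicz.rate Φ p N))) := by
  have key : ∀ (p : ℝ) (Φ : ℝ≥0 → ℝ≥0), 2 ≤ p → Orlicz.IsPhiFunction Φ → 0 < Φ 1 →
      ∀ a : ℝ≥0, Orlicz.AIncWith Φ p a → ∀ (N : ℕ), 1 ≤ N →
      ∀ (𝕜 : Type) [RCLike 𝕜] (d : ℕ) (Ω : Set (EuclideanSpace ℝ (Fin d))) [CompactSpace Ω]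
        (μ : Measure Ω) [IsProbabilityMeasure μ] (K B : ℝ≥0),
        Orlicz.IsQuasiTriangleConst 𝕜 Φ μ K →
        6 * K * a ^ (2 / p) * (1 + (Φ 1)⁻¹) ^ (1 / p) * Orlicz.rate Φ p N ≤ B →
        (∀ F : Set C(Ω, 𝕜), Orlicz.samplingNumber Φ μ F (6 * N) ≤
          B * Orlicz.kolmogorovWidth F N) ∧
        ∀ X : Submodule 𝕜 C(Ω, 𝕜), Module.finrank 𝕜 X = N →
          Orlicz.LeastSquaresRecovers Φ μ X (6 * N) B := by
    intro p Φ hp hΦ h1 a ha N hN 𝕜 _ d Ω _ μ _ K B hK hB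
    have hB' : 6 * K * Orlicz.errorFactor Φ p a N ≤ B := by
      refine le_of_eq_of_le ?_ hB
      rw [Orlicz.errorFactor]
      ring
    have hB0 : B ≠ 0 := by
      have h2 := hK.pos hΦ
      have h3 := zero_lt_one.trans_le (ha.one_le_errorFactor hΦ hp h1 hN)
      exact ((by positivity : 0 < 6 * K * Orlicz.errorFactor Φ p a N).trans_le hB').ne'
    have hrec : ∀ X : Submodule 𝕜 C(Ω, 𝕜), FiniteDimensional 𝕜 X → Module.finrank 𝕜 X ≤ N →
        Orlicz.LeastSquaresRecovers Φ μ X (6 * N) B := fun X _ hX =>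
      (ha.leastSquaresRecovers hΦ hp h1 hN hK X hX).mono hB'
    refine ⟨Orlicz.samplingNumber_le_mul_kolmogorovWidth hΦ hB0 hrec, fun X hX => ?_⟩
    -- `finrank` vanishes on infinite-dimensional spaces, so the value `N ≥ 1` forces finite
    -- dimension.
    exact hrec X (Module.finite_of_finrank_pos (hN.trans_eq hX.symm)) hX.le
  refine ⟨6, by norm_num, 6, by norm_num, fun p Φ hp hΦ hap h1 => ⟨?_, ?_⟩⟩
  · obtain ⟨a, ha⟩ := hap
    obtain ⟨b, hb⟩ := hΦ.aInc_one
    -- Here `4 b` is the quasi-triangle constant obtained from `(aInc)_1`, independent of `μ` and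
    -- `Ω`.
    refine ⟨max 1 (6 * (4 * b) * a ^ (2 / p) * (1 + (Φ 1)⁻¹) ^ (1 / p)), le_max_left _ _,
      fun N hN 𝕜 _ d Ω _ μ _ => key p Φ hp hΦ h1 a ha N hN 𝕜 d Ω μ (4 * b) _
        (hb.isQuasiTriangleConst hΦ) ?_⟩
    gcongr
    exact le_max_right _ _
  · exact fun a ha N hN 𝕜 _ d Ω _ μ _ K hK =>
      key p Φ hp hΦ h1 a ha N hN 𝕜 d Ω μ K _ hK le_rfl
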